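/- **Count formulae for non-induced graphlets on five nodes.** Let $G=(V,E)$ be a finite simple undirected graph with adjacency matrix $g$, and let $k_i$ be the degree of node $i$. For $b\ge 1$ and $a\ge 0$ let $M_a^{(b)}$ be the graph on $\{1,\dots,b\}$ whose adjacency matrix $h$ satisfies $a=\sum_{1\le i<j\le b}2^{\binom{b-i}{2}+(b-j)}h_{ij}$, and let $|M_a^{(b)}(H)|$ be the number of (not necessarily induced) subgraphs of a graph $H$ that are isomorphic to $M_a^{(b)}$; write $|M_a^{(b)}|=|M_a^{(b)}(G)|$. Let $\Gamma_G(i)$ be the neighbourhood of $i$ and $S(i,j)=\Gamma_G(i)\cap\Gamma_G(j)$. Let $G_{-i}$ be the subgraph of $G$ induced by $\Gamma_G(i)$, with adjacency matrix $g_{-i}$, node degrees $k^{(i)}_r$, edge set $E(G_{-i})$ and $m(g_{-i})$ edges; write $|M_a^{(b)}(g_{-i})|=|M_a^{(b)}(G_{-i})|$, and let $(g_{-i})_{-j}$ be the adjacency matrix of the subgraph of $G_{-i}$ induced by the neighbourhood of $j$ in $G_{-i}$. A sum over $(i,j)\in E$ takes each edge once, a sum over $(i,j)^\star\in E$ takes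 each edge in both directions, and a sum over $i,j:i\ne j$ is over ordered pairs of distinct nodes. Then: 1. (5-star) $|M_{75}^{(5)}|=\sum_{i:k_i>3}\binom{k_i}{4}=\frac1{24}\sum_{i:k_i>3}k_i(k_i-1)(k_i-2)(k_i-3)$. 2. (5-arrow) $|M_{77}^{(5)}|=\sum_{(i,j)^\star\in E,\,k_i>2}\binom{k_i-1}{2}(k_j-1)-2|M_{15}^{(4)}|=\frac12\sum_{(i,j)^\star\in E,\,k_i>2}(k_i-1)(k_i-2)(k_j-1)-2|M_{15}^{(4)}|$. 3. (cricket) $|M_{79}^{(5)}|=\frac12\sum_{i:k_i>3}(g^3)_{ii}\binom{k_i-2}{2}=\frac14\sum_{i:k_i>3}(g^3)_{ii}(k_i-2)(k_i-3)$. 4. (5-path) $|M_{86}^{(5)}|=\frac12\sum_{i,j:i\ne j}(g^4)_{ij}-2|M_3^{(3)}|-9|M_7^{(3)}|-3|M_{11}^{(4)}|-2|M_{13}^{(4)}|-2|M_{15}^{(4)}|$. 5. (bull) $|M_{87}^{(5)}|=\sum_{(i,j)\in E,\,k_i>2,\,k_j>2}(g^2)_{ij}(k_i-2)(k_j-2)-2|M_{31}^{(4)}|$.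 6. (banner) $|M_{94}^{(5)}|=\sum_{i,j:i\ne j,\,k_i>2}\binom{(g^2)_{ij}}{2}(k_i-2)-2|M_{31}^{(4)}|=\frac12\sum_{i,j:i\ne j,\,k_i>2}(g^2)_{ij}((g^2)_{ij}-1)(k_i-2)-2|M_{31}^{(4)}|$. 7. (stingray) $|M_{95}^{(5)}|=\sum_{i,j:i\ne j,\,k_i>3}\binom{(g^2)_{ij}(g)_{ij}}{2}(k_i-3)=\frac12\sum_{(i,j)^\star\in E,\,k_i>3}(g^2)_{ij}((g^2)_{ij}-1)(k_i-3)$. 8. (lollipop) $|M_{117}^{(5)}|=\frac12\sum_{(i,j)^\star\in E}(g^3)_{ii}(k_j-1)-6|M_7^{(3)}|-2|M_{15}^{(4)}|-4|M_{31}^{(4)}|$. 9. (spinning top) $|M_{119}^{(5)}|=\sum_{(i,j)\in E,\,k_i>2,\,k_j>2}((g^2)_{ij}-1)\sum_{r\in S(i,j),\,k_r>1}(k_r-2)-12|M_{63}^{(4)}|$. 10. (kite) $|M_{127}^{(5)}|=\sum_{i:k_i>3}|M_7^{(3)}(g_{-i})|(k_i-3)=\frac16\sum_{i:k_i>3}\operatorname{tr}(g_{-i}^3)(k_i-3)$.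 11. (ufo) $|M_{222}^{(5)}|=\frac12\sum_{i,j:i\ne j,\,k_i>2,\,k_j>2}\binom{(g^2)_{ij}}{3}=\frac1{12}\sum_{i,j:i\ne j,\,k_i>2,\,k_j>2}(g^2)_{ij}((g^2)_{ij}-1)((g^2)_{ij}-2)$. 12. (chevron) $|M_{223}^{(5)}|=\frac12\sum_{i,j:i\ne j,\,k_i>3,\,k_j>3}\binom{(g^2)_{ij}(g)_{ij}}{3}=\frac16\sum_{(i,j)\in E,\,k_i>3,\,k_j>3}(g^2)_{ij}((g^2)_{ij}-1)((g^2)_{ij}-2)$. 13. (hourglass) $|M_{235}^{(5)}|=\sum_{i:k_i>2}\binom{\frac12(g^3)_{ii}}{2}-2|M_{31}^{(4)}|=\frac18\sum_{i:k_i>2}(g^3)_{ii}((g^3)_{ii}-2)-2|M_{31}^{(4)}|$. 14. (5-circle) $|M_{236}^{(5)}|=\frac1{10}\left(\operatorname{tr}(g^5)-30|M_7^{(3)}|-10|M_{15}^{(4)}|\right)$. 15. (house) $|M_{237}^{(5)}|=\sum_{(i,j)\in E}(g^3)_{ij}(g^2)_{ij}-9|M_7^{(3)}|-2|M_{15}^{(4)}|-4|M_{31}^{(4)}|$.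 16. (crown) $|M_{239}^{(5)}|=\sum_{i:k_i>3}|M_{13}^{(4)}(g_{-i})|=\sum_{i:k_i>3}\left(\sum_{(j,r)\in E(G_{-i})}(k^{(i)}_j-1)(k^{(i)}_r-1)-3|M_7^{(3)}(g_{-i})|\right)$. 17. (envelope) $|M_{254}^{(5)}|=\sum_{(i,j)\in E,\,k_i>2,\,k_j>2}\ \sum_{\{r,q\}\subseteq S(i,j),\,r\ne q,\,k_r>2,\,k_q>2}((g^2)_{rq}-2)$, where the inner sum is over unordered pairs $\{r,q\}$. 18. (lamp) $|M_{255}^{(5)}|=\frac12\sum_{i:k_i>3}|M_{15}^{(4)}(g_{-i})|=\frac14\sum_{i:k_i>3}\ \sum_{r\in\Gamma_G(i),\,k^{(i)}_r>2}(g_{-i}^3)_{rr}(k^{(i)}_r-2)$. 19. (arrowhead) $|M_{507}^{(5)}|=\sum_{i:k_i>3}|M_{30}^{(4)}(g_{-i})|=\frac18\sum_{i:k_i>3}\left(\operatorname{tr}(g_{-i}^4)-2\,m(g_{-i})-4|M_3^{(3)}(g_{-i})|\right)$. 20. (cat's cradle) $|M_{511}^{(5)}|=\frac13\sum_{i:k_i>3}|M_{31}^{(4)}(g_{-i})|=\frac16\sum_{i:k_i>3}\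 \sum_{r,s\in\Gamma_G(i):\,r\ne s,\,k^{(i)}_r>2,\,k^{(i)}_s>2}\binom{(g_{-i}^2)_{rs}(g_{-i})_{rs}}{2}$. 21. (5-complete) $|M_{1023}^{(5)}|=\frac15\sum_{i:k_i>3}|M_{63}^{(4)}(g_{-i})|=\frac1{120}\sum_{i:k_i>3}\ \sum_{j\in\Gamma_G(i),\,k^{(i)}_j>2}\operatorname{tr}\left(((g_{-i})_{-j})^3\right)$. -/

import Mathlib

/-- The graph `M_a^{(b)}` on `b` nodes with code `a`. The nodes are `0, …, b - 1`, and for `i < j`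
the edge `ij` is present iff the binary digit of `a` of weight `2 ^ (C(b-1-i, 2) + (b-1-j))` is one
(the row-by-row reading of the upper triangle of the adjacency matrix). -/
def graphlet (b a : ℕ) : SimpleGraph (Fin b) :=
  SimpleGraph.fromRel fun i j =>
    i < j ∧ a.testBit ((b - 1 - (i : ℕ)).choose 2 + (b - 1 - (j : ℕ))) = true

/-- The non-induced count `|M_a^{(b)}(G)|`: the number of (not necessarily induced) subgraphs of `G`
that are isomorphic to `M_a^{(b)}`. -/
noncomputable def graphletCount (b a : ℕ) {V : Type*} (G : SimpleGraph V) : ℕ :=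
  Nat.card {H : G.Subgraph // Nonempty (H.coe ≃g graphlet b a)}

/-- The subgraph of `G` induced by the neighbourhood of `i`; its adjacency matrix is `g_{-i}`. -/
abbrev nbhd {V : Type*} (G : SimpleGraph V) (i : V) : SimpleGraph (G.neighborSet i) :=
  G.induce (G.neighborSet i)

/-- The sum of `F i j` over the edges `ij` of `G`, each edge taken once, for a symmetric `F`: half
of the sum over the two orientations of each edge (see `edgeSum_eq`). -/
def edgeSum {V : Type*} [Fintype V] (G : SimpleGraph V) [DecidableRel G.Adj]
    (F : V → V → ℚ) : ℚ :=
  1 / 2 * ∑ i, ∑ j with G.Adj i j, F i j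

theorem edgeSum_eq {V : Type*} [Fintype V] [DecidableEq V] (G : SimpleGraph V)
    [DecidableRel G.Adj] (F : V → V → ℚ) (hF : ∀ i j, F i j = F j i) :
    edgeSum G F = ∑ e ∈ G.edgeFinset, Sym2.lift ⟨F, hF⟩ e := by
  have h1 : ∑ i, ∑ j with G.Adj i j, F i j = ∑ d : G.Dart, Sym2.lift ⟨F, hF⟩ d.edge := by
    rw [Finset.sum_sigma']
    refine Finset.sum_bij' (fun x hx => ⟨(x.1, x.2), by simpa using hx⟩)
      (fun d _ => ⟨d.fst, d.snd⟩) ?_ ?_ ?_ ?_ ?_ <;> simp [SimpleGraph.Dart.edge]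
  have h2 : ∑ d : G.Dart, Sym2.lift ⟨F, hF⟩ d.edge
      = ∑ e ∈ G.edgeFinset, 2 * Sym2.lift ⟨F, hF⟩ e := by
    rw [← Finset.sum_fiberwise_of_maps_to (s := Finset.univ) (t := G.edgeFinset)
      (g := fun d : G.Dart => d.edge) (fun d _ => by simp)]
    refine Finset.sum_congr rfl fun e he => ?_
    rw [Finset.sum_congr rfl (g := fun _ => Sym2.lift ⟨F, hF⟩ e)
      (fun d hd => by rw [(Finset.mem_filter.1 hd).2]), Finset.sum_const,
      G.dart_edge_fiber_card e (by simpa using he)]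
    simp
  rw [edgeSum, h1, h2, ← Finset.mul_sum]
  ring

/-! Every count is passed to labelled copies. Edge-preserving injections of a pattern into `G`
correspond to a copy together with an isomorphism from the pattern onto it, so their number is the
order of the automorphism group times the number of copies (`card_copy_eq`). The indicator of such
an injection is a product over pairs of vertices: adjacency where the pattern has an edge,
distinctness elsewhere (`graphletCount_eq_sum_prod`). The labelled count is thus an iterated sum of
products of 0/1 weights.

These sums are evaluated from the innermost vertex outwards. A distinctness constraint is removed by
subtracting the summand at the forbidden vertex (`sum_mul_neInd` and its variants). What remains is
a polynomial in degrees, codegrees and closed walks of length three; the subtracted terms are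
labelled counts of smaller graphlets, and these give the correction terms. A vertex order is chosen
for each pattern so that the inner sums are easy. When corrections live on a triangle they are
compared through `triangleSum`, which is invariant under relabelling the triangle.

For the 5-path and the 5-circle the starting objects are walks: the corrections remove the walks
that repeat a vertex.

Kite, crown, lamp, arrowhead, cat's cradle and the complete graphs contain a vertex joined to all
others, or to all but one leaf for the kite. Fixing its image `x` turns the labelled sum into one
over the neighbourhood of `x`, and the numerical factor is the number of possible choices of that
vertex in a copy.

Finally, the degree restrictions in the sums remove only vanishing terms. This follows from the
bound of the codegree by the degree, strict along an edge, and from the absence of graphlets on more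
vertices than the neighbourhood has. -/

set_option linter.unusedSectionVars false

/-! ### Labelled and unlabelled copies -/

section CopyCount

variable {V W : Type*}

/-- A labelled copy of `H` in `G` is the same as a subgraph of `G` together with an isomorphism
from `H` onto it. -/
theorem bijective_sigma_iso_copy (G : SimpleGraph V) (H : SimpleGraph W) :
    Function.Bijective (fun p : (S : {S : G.Subgraph // Nonempty (S.coe ≃g H)}) × (H ≃g S.1.coe) =>
      p.1.1.coeCopy.comp p.2.toCopy) := by
  constructor
  · rintro ⟨⟨S, hS⟩, e⟩ ⟨⟨T, hT⟩, f⟩ h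
    have hv : ∀ x, (e x : V) = f x := fun x => DFunLike.congr_fun h x
    have hST : S = T := by
      ext x y
      · constructor
        · intro hx
          have := hv (e.symm ⟨x, hx⟩)
          rw [e.apply_symm_apply] at this
          have hx' : x = f (e.symm ⟨x, hx⟩) := this
          rw [hx']
          exact (f _).2
        · intro hx
          have := hv (f.symm ⟨x, hx⟩)
          rw [f.apply_symm_apply] at this
          have hx' : e (f.symm ⟨x, hx⟩) = x := this
          rw [← hx']
          exact (e _).2
      · constructor
        · intro hxy
          have h1 : S.coe.Adj ⟨x, hxy.fst_mem⟩ ⟨y, hxy.snd_mem⟩ := hxy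
          rw [← e.symm.map_adj_iff, ← f.map_adj_iff, SimpleGraph.Subgraph.coe_adj, ← hv, ← hv,
            e.apply_symm_apply, e.apply_symm_apply] at h1
          exact h1
        · intro hxy
          have h1 : T.coe.Adj ⟨x, hxy.fst_mem⟩ ⟨y, hxy.snd_mem⟩ := hxy
          rw [← f.symm.map_adj_iff, ← e.map_adj_iff, SimpleGraph.Subgraph.coe_adj, hv, hv,
            f.apply_symm_apply, f.apply_symm_apply] at h1
          exact h1
    subst hST
    have hef : e = f := by
      ext x
      exact hv x
    rw [hef]
  · intro f
    refine ⟨⟨⟨f.toSubgraph, ⟨f.isoToSubgraph.symm⟩⟩, f.isoToSubgraph⟩, ?_⟩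
    ext x
    rfl

/-- The number of labelled copies is the number of copies times the number of automorphisms. -/
theorem card_copy_eq (G : SimpleGraph V) (H : SimpleGraph W) [Finite V] [Finite W] :
    Nat.card (H.Copy G)
      = Nat.card (H ≃g H) * Nat.card {S : G.Subgraph // Nonempty (S.coe ≃g H)} := by
  classical
  have := Fintype.ofFinite V
  have := Fintype.ofFinite W
  have hfin : ∀ S : {S : G.Subgraph // Nonempty (S.coe ≃g H)}, Finite (H ≃g S.1.coe) := fun S =>
    DFunLike.finite _
  rw [← Nat.card_congr (Equiv.ofBijective _ (bijective_sigma_iso_copy G H)), Nat.card_sigma,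
    Finset.sum_congr rfl (g := fun _ => Nat.card (H ≃g H)), Finset.sum_const, smul_eq_mul,
    mul_comm, Finset.card_univ, Nat.card_eq_fintype_card (α := {S : G.Subgraph // _})]
  rintro ⟨S, ⟨e⟩⟩ -
  exact Nat.card_congr
    ⟨fun f => f.trans e, fun f => f.trans e.symm, fun f => by ext; simp, fun f => by ext; simp⟩

end CopyCount

/-- Lets the automorphism count and the edge pattern of each concrete graphlet be settled by kernel
evaluation. -/
instance graphletDecidableAdj (b a : ℕ) : DecidableRel (graphlet b a).Adj := fun i j =>
  inferInstanceAs (Decidable (i ≠ j ∧ ((_ ∧ _) ∨ (_ ∧ _))))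

/-- The automorphisms of a graph as a decidable subtype of permutations. -/
def permEquivAut {W : Type*} (H : SimpleGraph W) :
    {σ : Equiv.Perm W // ∀ i j, H.Adj (σ i) (σ j) ↔ H.Adj i j} ≃ (H ≃g H) where
  toFun σ := ⟨σ.1, σ.2 _ _⟩
  invFun f := ⟨f.toEquiv, fun _ _ => f.map_adj_iff⟩
  left_inv _ := rfl
  right_inv _ := rfl


/-! ### Labelled counts as sums of products of indicators -/

section Indicators

variable {V : Type*} [DecidableEq V]

/-- The adjacency indicator with values in `ℚ`. -/
def adjInd (G : SimpleGraph V) [DecidableRel G.Adj] (x y : V) : ℚ := if G.Adj x y then 1 else 0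

/-- The indicator of `x ≠ y` with values in `ℚ`. -/
def neInd (x y : V) : ℚ := if x = y then 0 else 1

/-- The weight of a pair of vertices of a labelled copy: adjacency if the pattern has an edge
there, and distinctness otherwise. -/
def pairWeight (G : SimpleGraph V) [DecidableRel G.Adj] (b : Bool) (x y : V) : ℚ :=
  match b with
  | true => adjInd G x y
  | false => neInd x y

/-- Adjacency already entails distinctness, so both kinds of weight enforce injectivity on their
pair, and the product over all pairs detects exactly the edge-preserving injections. -/
theorem pairWeight_eq_ite (G : SimpleGraph V) [DecidableRel G.Adj] (b : Bool) (x y : V) :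
    pairWeight G b x y = if x ≠ y ∧ (b = true → G.Adj x y) then 1 else 0 := by
  cases b
  · by_cases h : x = y <;> simp [pairWeight, neInd, h]
  · by_cases h : G.Adj x y
    · simp [pairWeight, adjInd, h, h.ne]
    · simp [pairWeight, adjInd, h]

theorem sum_fin_succ_pi {V : Type*} [Fintype V] {n : ℕ} (F : (Fin (n + 1) → V) → ℚ) :
    ∑ x, F x = ∑ a, ∑ x, F (Matrix.vecCons a x) := by
  rw [← (Fin.consEquiv fun _ => V).sum_comp, Fintype.sum_prod_type]
  rfl

/-- The number of labelled copies of a graph on `Fin b` as a sum of products of pair weights, with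
the vertices of the pattern listed in the order `s`. -/
theorem graphletCount_eq_sum_prod [Fintype V] (G : SimpleGraph V) [DecidableRel G.Adj]
    (b a c : ℕ) (s : Fin b → Fin b) (hs : Function.Injective s)
    (hc : Fintype.card {σ : Equiv.Perm (Fin b) // ∀ i j,
      (graphlet b a).Adj (σ i) (σ j) ↔ (graphlet b a).Adj i j} = c) :
    c * (graphletCount b a G : ℚ) = ∑ y : Fin b → V, ∏ j, ∏ i,
      if i < j then pairWeight G (decide ((graphlet b a).Adj (s i) (s j))) (y i) (y j) else 1 := by
  have h1 : Nat.card (graphlet b a ≃g graphlet b a) = c := by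
    rw [← hc, ← Nat.card_eq_fintype_card]
    exact (Nat.card_congr (permEquivAut _)).symm
  have h2 := card_copy_eq G (graphlet b a)
  rw [h1] at h2
  let e : Fin b ≃ Fin b := Equiv.ofBijective s (Finite.injective_iff_bijective.1 hs)
  have h3 : Nat.card ((graphlet b a).Copy G) = Nat.card {y : Fin b → V //
      Function.Injective y ∧ ∀ i j, (graphlet b a).Adj (s i) (s j) → G.Adj (y i) (y j)} := by
    -- A copy `f` is recorded as the tuple `y i = f (s i)`; since `s` is a permutation nothing is
    -- lost.
    refine Nat.card_congr ⟨fun f => ⟨fun i => f (s i), f.injective.comp hs,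
      fun i j h => f.toHom.map_adj h⟩, fun y => ⟨⟨fun i => y.1 (e.symm i), fun {i j} h =>
      y.2.2 _ _ ?_⟩, fun i j h => e.symm.injective (y.2.1 h)⟩, fun f => ?_, fun y => ?_⟩
    · change (graphlet b a).Adj (e (e.symm i)) (e (e.symm j))
      simpa using h
    · ext i
      exact congrArg f (e.apply_symm_apply i)
    · ext i
      exact congrArg y.1 (e.symm_apply_apply i)
  unfold graphletCount
  rw [← Nat.cast_mul, ← h2, h3, Nat.card_eq_fintype_card, Fintype.card_subtype, Finset.card_filter,
    Nat.cast_sum]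
  refine Finset.sum_congr rfl fun y _ => ?_
  simp only [pairWeight_eq_ite, decide_eq_true_eq]
  rw [Nat.cast_ite, Nat.cast_one, Nat.cast_zero]
  split_ifs with h
  · symm
    refine Finset.prod_eq_one fun j _ => Finset.prod_eq_one fun i _ => ?_
    split_ifs with h4 h5
    · rfl
    · exact absurd ⟨h.1.ne h4.ne, h.2 i j⟩ h5
    · rfl
  -- A nonzero product has every factor nonzero, which gives the conditions for all pairs `i < j`;
  -- symmetry covers the rest.
  · symm
    by_contra h0
    apply h
    have h4 : ∀ i j, i < j → y i ≠ y j ∧ ((graphlet b a).Adj (s i) (s j) → G.Adj (y i) (y j)) := by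
      intro i j hij
      by_contra h5
      exact h0 (Finset.prod_eq_zero (Finset.mem_univ j)
        (Finset.prod_eq_zero (Finset.mem_univ i) (by rw [if_pos hij, if_neg h5])))
    refine ⟨fun i j hij => ?_, fun i j hij => ?_⟩
    · rcases lt_trichotomy i j with h5 | h5 | h5
      · exact absurd hij (h4 i j h5).1
      · exact h5
      · exact absurd hij.symm (h4 j i h5).1
    · rcases lt_trichotomy i j with h5 | h5 | h5
      · exact (h4 i j h5).2 hij
      · exact absurd (h5 ▸ hij) ((graphlet b a).loopless.irrefl _)
      · exact ((h4 j i h5).2 hij.symm).symm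

/-- The Booleans are the edges and non-edges of the pattern in the order `s`. The weights of each
new vertex stay with the sum over it, so that inner sums can be evaluated while the earlier vertices
are fixed. -/
theorem graphletCount_three [Fintype V] (G : SimpleGraph V) [DecidableRel G.Adj]
    (a c : ℕ) (s : Fin 3 → Fin 3) (b01 b02 b12 : Bool) (hs : Function.Injective s)
    (hc : Fintype.card {σ : Equiv.Perm (Fin 3) // ∀ i j,
      (graphlet 3 a).Adj (σ i) (σ j) ↔ (graphlet 3 a).Adj i j} = c)
    (hb : decide ((graphlet 3 a).Adj (s 0) (s 1)) = b01 ∧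
      decide ((graphlet 3 a).Adj (s 0) (s 2)) = b02 ∧
      decide ((graphlet 3 a).Adj (s 1) (s 2)) = b12) :
    c * (graphletCount 3 a G : ℚ) = ∑ v, ∑ w, pairWeight G b01 v w *
      ∑ x, pairWeight G b02 v x * pairWeight G b12 w x := by
  rw [graphletCount_eq_sum_prod G 3 a c s hs hc]
  obtain ⟨rfl, rfl, rfl⟩ := hb
  simp only [sum_fin_succ_pi, Finset.mul_sum]
  simp [Fin.prod_univ_three]

theorem graphletCount_four [Fintype V] (G : SimpleGraph V) [DecidableRel G.Adj]
    (a c : ℕ) (s : Fin 4 → Fin 4) (b01 b02 b12 b03 b13 b23 : Bool) (hs : Function.Injective s)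
    (hc : Fintype.card {σ : Equiv.Perm (Fin 4) // ∀ i j,
      (graphlet 4 a).Adj (σ i) (σ j) ↔ (graphlet 4 a).Adj i j} = c)
    (hb : decide ((graphlet 4 a).Adj (s 0) (s 1)) = b01 ∧
      decide ((graphlet 4 a).Adj (s 0) (s 2)) = b02 ∧
      decide ((graphlet 4 a).Adj (s 1) (s 2)) = b12 ∧
      decide ((graphlet 4 a).Adj (s 0) (s 3)) = b03 ∧
      decide ((graphlet 4 a).Adj (s 1) (s 3)) = b13 ∧
      decide ((graphlet 4 a).Adj (s 2) (s 3)) = b23) :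
    c * (graphletCount 4 a G : ℚ) = ∑ v, ∑ w, pairWeight G b01 v w *
      ∑ x, pairWeight G b02 v x * (pairWeight G b12 w x *
      ∑ y, pairWeight G b03 v y * (pairWeight G b13 w y * pairWeight G b23 x y)) := by
  rw [graphletCount_eq_sum_prod G 4 a c s hs hc]
  obtain ⟨rfl, rfl, rfl, rfl, rfl, rfl⟩ := hb
  simp only [sum_fin_succ_pi, Finset.mul_sum]
  simp [Fin.prod_univ_four, mul_assoc]

theorem graphletCount_five [Fintype V] (G : SimpleGraph V) [DecidableRel G.Adj]
    (a c : ℕ) (s : Fin 5 → Fin 5) (b01 b02 b12 b03 b13 b23 b04 b14 b24 b34 : Bool)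
    (hs : Function.Injective s)
    (hc : Fintype.card {σ : Equiv.Perm (Fin 5) // ∀ i j,
      (graphlet 5 a).Adj (σ i) (σ j) ↔ (graphlet 5 a).Adj i j} = c)
    (hb : decide ((graphlet 5 a).Adj (s 0) (s 1)) = b01 ∧
      decide ((graphlet 5 a).Adj (s 0) (s 2)) = b02 ∧
      decide ((graphlet 5 a).Adj (s 1) (s 2)) = b12 ∧
      decide ((graphlet 5 a).Adj (s 0) (s 3)) = b03 ∧
      decide ((graphlet 5 a).Adj (s 1) (s 3)) = b13 ∧
      decide ((graphlet 5 a).Adj (s 2) (s 3)) = b23 ∧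
      decide ((graphlet 5 a).Adj (s 0) (s 4)) = b04 ∧
      decide ((graphlet 5 a).Adj (s 1) (s 4)) = b14 ∧
      decide ((graphlet 5 a).Adj (s 2) (s 4)) = b24 ∧
      decide ((graphlet 5 a).Adj (s 3) (s 4)) = b34) :
    c * (graphletCount 5 a G : ℚ) = ∑ v, ∑ w, pairWeight G b01 v w *
      ∑ x, pairWeight G b02 v x * (pairWeight G b12 w x *
      ∑ y, pairWeight G b03 v y * (pairWeight G b13 w y * (pairWeight G b23 x y *
      ∑ z, pairWeight G b04 v z * (pairWeight G b14 w z * (pairWeight G b24 x z *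
        pairWeight G b34 y z))))) := by
  rw [graphletCount_eq_sum_prod G 5 a c s hs hc]
  obtain ⟨rfl, rfl, rfl, rfl, rfl, rfl, rfl, rfl, rfl, rfl⟩ := hb
  simp only [sum_fin_succ_pi, Finset.mul_sum]
  simp [Fin.prod_univ_five, mul_assoc]

end Indicators

/-! ### Calculus of indicators, degrees, codegrees and walks -/

section IndicatorCalculus

variable {V : Type*} [DecidableEq V] (G : SimpleGraph V) [DecidableRel G.Adj]

theorem adjInd_comm (x y : V) : adjInd G x y = adjInd G y x := by
  simp only [adjInd, G.adj_comm]

@[simp] theorem adjInd_self (x : V) : adjInd G x x = 0 := by simp [adjInd]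

@[simp] theorem neInd_self (x : V) : neInd x x = 0 := by simp [neInd]

variable {G} in
theorem adjInd_of_adj {x y : V} (h : G.Adj x y) : adjInd G x y = 1 := if_pos h

theorem neInd_of_ne {x y : V} (h : x ≠ y) : neInd x y = 1 := if_neg h

@[simp] theorem adjInd_mul_self (x y : V) : adjInd G x y * adjInd G x y = adjInd G x y := by
  unfold adjInd; split_ifs <;> simp

@[simp] theorem adjInd_mul_neInd (x y : V) : adjInd G x y * neInd x y = adjInd G x y := by
  by_cases h : x = y
  · simp [h]
  · simp [neInd_of_ne h]

variable {G} in
-- An indicator factor acts as a hypothesis: the cofactors need to agree only where it is nonzero.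
-- Chaining this lemma peels off the nested weights one at a time.
theorem adjInd_mul_congr {x y : V} {p q : ℚ} (h : G.Adj x y → p = q) :
    adjInd G x y * p = adjInd G x y * q := by
  by_cases hxy : G.Adj x y
  · rw [h hxy]
  · simp [adjInd, hxy]

theorem neInd_mul_congr {x y : V} {p q : ℚ} (h : x ≠ y → p = q) :
    neInd x y * p = neInd x y * q := by
  by_cases hxy : x = y
  · simp [neInd, hxy]
  · rw [h hxy]

variable [Fintype V]

theorem sum_mul_neInd (f : V → ℚ) (x : V) : ∑ z, f z * neInd x z = ∑ z, f z - f x := by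
  simp [neInd, mul_ite, Finset.sum_ite, Finset.filter_ne, Finset.sum_erase_eq_sub]

/-- The excluded vertices are distinct, so each is subtracted exactly once and no
inclusion-exclusion overlap arises. -/
theorem sum_mul_neInd_two (f : V → ℚ) {x y : V} (hxy : x ≠ y) :
    ∑ z, f z * (neInd x z * neInd y z) = ∑ z, f z - f x - f y := by
  have h := sum_mul_neInd (fun z => f z * neInd x z) y
  simp only [sum_mul_neInd, neInd_of_ne hxy, mul_one, mul_assoc] at h
  exact h

theorem sum_mul_neInd_three (f : V → ℚ) {x y w : V} (hxy : x ≠ y) (hxw : x ≠ w) (hyw : y ≠ w) :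
    ∑ z, f z * (neInd x z * (neInd y z * neInd w z)) = ∑ z, f z - f x - f y - f w := by
  have h := sum_mul_neInd (fun z => f z * (neInd x z * neInd y z)) w
  simp only [sum_mul_neInd_two f hxy, neInd_of_ne hxw, neInd_of_ne hyw, mul_one, mul_assoc] at h
  exact h

/-- An idempotent rational is 0 or 1, so `a = 1` may be assumed under the factor `a`. -/
theorem idem_mul_congr {a p q : ℚ} (ha : a * a = a) (h : a = 1 → p = q) : a * p = a * q := by
  rcases mul_eq_zero.1 (show a * (a - 1) = 0 by linarith) with h0 | h1
  · simp [h0]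
  · rw [h (by linarith)]

/-- An idempotent `f` is the indicator of a set, and ordered pairs of distinct elements of a set are
counted by a falling factorial. The versions for triples and quadruples add one element at a time.
-/
theorem sum_pairs (f : V → ℚ) (hf : ∀ x, f x * f x = f x) :
    ∑ x, f x * ∑ y, f y * neInd x y = (∑ x, f x) * (∑ x, f x - 1) := by
  simp only [sum_mul_neInd]
  rw [Finset.sum_mul]
  exact Finset.sum_congr rfl fun x _ => idem_mul_congr (hf x) fun h => by rw [h]

theorem sum_triples (f : V → ℚ) (hf : ∀ x, f x * f x = f x) :
    ∑ x, f x * ∑ y, f y * (neInd x y * ∑ z, f z * (neInd x z * neInd y z))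
      = (∑ x, f x) * (∑ x, f x - 1) * (∑ x, f x - 2) := by
  rw [← sum_pairs f hf, Finset.sum_mul]
  refine Finset.sum_congr rfl fun x _ => ?_
  rw [mul_assoc]
  refine idem_mul_congr (hf x) fun hx => ?_
  rw [Finset.sum_mul]
  refine Finset.sum_congr rfl fun y _ => ?_
  rw [mul_assoc]
  refine idem_mul_congr (hf y) fun hy => neInd_mul_congr fun hxy => ?_
  rw [sum_mul_neInd_two f hxy, hx, hy]
  ring

theorem sum_quadruples (f : V → ℚ) (hf : ∀ x, f x * f x = f x) :
    ∑ x, f x * ∑ y, f y * (neInd x y * ∑ z, f z * (neInd x z * (neInd y z *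
      ∑ w, f w * (neInd x w * (neInd y w * neInd z w)))))
      = (∑ x, f x) * (∑ x, f x - 1) * (∑ x, f x - 2) * (∑ x, f x - 3) := by
  rw [← sum_triples f hf, Finset.sum_mul]
  refine Finset.sum_congr rfl fun x _ => ?_
  rw [mul_assoc]
  refine idem_mul_congr (hf x) fun hx => ?_
  rw [Finset.sum_mul]
  refine Finset.sum_congr rfl fun y _ => ?_
  rw [mul_assoc]
  refine idem_mul_congr (hf y) fun hy => ?_
  rw [mul_assoc]
  refine neInd_mul_congr fun hxy => ?_
  rw [Finset.sum_mul]
  refine Finset.sum_congr rfl fun z _ => ?_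
  rw [mul_assoc]
  refine idem_mul_congr (hf z) fun hz => ?_
  rw [mul_assoc]
  refine neInd_mul_congr fun hxz => neInd_mul_congr fun hyz => ?_
  rw [sum_mul_neInd_three f hxy hxz hyz, hx, hy, hz]
  ring

/-- The degree as a rational number. -/
def deg (x : V) : ℚ := ∑ y, adjInd G x y

/-- The number of common neighbours as a rational number. -/
def codeg (x y : V) : ℚ := ∑ z, adjInd G x z * adjInd G y z

/-- The number of closed walks of length three from `x`. -/
def triWalks (x : V) : ℚ := ∑ y, adjInd G x y * codeg G x y

theorem codeg_comm (x y : V) : codeg G x y = codeg G y x := by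
  simp only [codeg, mul_comm]

@[simp] theorem codeg_self (x : V) : codeg G x x = deg G x := by
  simp [codeg, deg]

theorem adjInd_pair_idem (x y z : V) :
    adjInd G x z * adjInd G y z * (adjInd G x z * adjInd G y z) = adjInd G x z * adjInd G y z := by
  rw [mul_mul_mul_comm, adjInd_mul_self, adjInd_mul_self]

theorem degree_eq_deg (x : V) [Fintype (G.neighborSet x)] : (G.degree x : ℚ) = deg G x := by
  simp only [deg, adjInd, Finset.sum_boole]
  rw [← SimpleGraph.card_neighborFinset_eq_degree]
  congr 2
  ext y
  simp

theorem cast_pow_apply (n : ℕ) (x y : V) :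
    (((G.adjMatrix ℕ) ^ n) x y : ℚ) = ((G.adjMatrix ℚ) ^ n) x y := by
  have h : G.adjMatrix ℚ = (G.adjMatrix ℕ).map (Nat.castRingHom ℚ) := by
    ext x y
    simp [SimpleGraph.adjMatrix_apply]
  rw [h, ← Matrix.map_pow]
  rfl

theorem cast_pow_two (x y : V) : (((G.adjMatrix ℕ) ^ 2) x y : ℚ) = codeg G x y := by
  rw [cast_pow_apply, pow_two, Matrix.mul_apply]
  refine Finset.sum_congr rfl fun z _ => ?_
  rw [adjInd_comm G y z]
  rfl

theorem cast_pow_three (x y : V) :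
    (((G.adjMatrix ℕ) ^ 3) x y : ℚ) = ∑ z, adjInd G x z * codeg G z y := by
  rw [cast_pow_apply, pow_succ', Matrix.mul_apply]
  refine Finset.sum_congr rfl fun z _ => ?_
  rw [← cast_pow_two, cast_pow_apply]
  rfl

theorem cast_pow_three_diag (x : V) : (((G.adjMatrix ℕ) ^ 3) x x : ℚ) = triWalks G x := by
  rw [cast_pow_three]
  simp only [codeg_comm G _ x]
  rfl

theorem cast_pow_four (x y : V) :
    (((G.adjMatrix ℕ) ^ 4) x y : ℚ) = ∑ z, codeg G x z * codeg G z y := by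
  rw [cast_pow_apply, show 4 = 2 + 2 from rfl, pow_add, Matrix.mul_apply]
  simp only [← cast_pow_apply, cast_pow_two]

theorem cast_pow_five (x y : V) :
    (((G.adjMatrix ℕ) ^ 5) x y : ℚ) = ∑ z, (∑ w, adjInd G x w * codeg G w z) * codeg G z y := by
  rw [cast_pow_apply, show 5 = 3 + 2 from rfl, pow_add, Matrix.mul_apply]
  simp only [← cast_pow_apply, cast_pow_two, cast_pow_three]

theorem sum_neighborSet (x : V) [Fintype (G.neighborSet x)] (f : V → ℚ) :
    ∑ y : G.neighborSet x, f y = ∑ y, adjInd G x y * f y := by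
  simp only [adjInd, ite_mul, one_mul, zero_mul, ← Finset.sum_filter]
  exact (Finset.sum_subtype _ (by simp) f).symm

theorem sum_adj (x : V) (f : V → ℚ) : ∑ y with G.Adj x y, f y = ∑ y, adjInd G x y * f y := by
  simp [adjInd, Finset.sum_filter]

theorem sum_ne (x : V) (f : V → ℚ) : ∑ y with x ≠ y, f y = ∑ y, neInd x y * f y := by
  simp [neInd, Finset.sum_filter]

theorem edgeSum_eq_sum (F : V → V → ℚ) :
    edgeSum G F = 1 / 2 * ∑ x, ∑ y, adjInd G x y * F x y := by
  simp only [edgeSum, sum_adj]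

theorem graphletCount_eq_zero_of_card_lt {U : Type*} [Fintype U] (H : SimpleGraph U) {b : ℕ}
    (a : ℕ) (h : Fintype.card U < b) : graphletCount b a H = 0 := by
  have : IsEmpty {S : H.Subgraph // Nonempty (S.coe ≃g graphlet b a)} := by
    refine ⟨fun ⟨S, ⟨e⟩⟩ => ?_⟩
    have := Fintype.card_le_of_injective (fun i => (e.symm i : U))
      (Subtype.val_injective.comp e.symm.injective)
    rw [Fintype.card_fin] at this
    omega
  exact Nat.card_eq_zero.2 (Or.inl this)

end IndicatorCalculus

/-! ### Labelled counts of the graphlets without cone structure, and of the smaller graphlets -/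

section LabelledCounts

variable {V : Type*} [DecidableEq V] [Fintype V] (G : SimpleGraph V) [DecidableRel G.Adj]

/-- Leaves the factorisation of the summand as a hypothesis, so that a nested product can be
rearranged by `ring`. -/
theorem sum_eq_sub_one {g : V → ℚ} (f : V → ℚ) {x : V} (hg : ∀ z, g z = f z * neInd x z) :
    ∑ z, g z = ∑ z, f z - f x := by
  rw [← sum_mul_neInd]
  exact Finset.sum_congr rfl fun z _ => hg z

theorem sum_eq_sub_two {g : V → ℚ} (f : V → ℚ) {x y : V} (hxy : x ≠ y)
    (hg : ∀ z, g z = f z * (neInd x z * neInd y z)) : ∑ z, g z = ∑ z, f z - f x - f y := by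
  rw [← sum_mul_neInd_two f hxy]
  exact Finset.sum_congr rfl fun z _ => hg z

theorem sum_eq_sub_three {g : V → ℚ} (f : V → ℚ) {x y w : V} (hxy : x ≠ y) (hxw : x ≠ w)
    (hyw : y ≠ w) (hg : ∀ z, g z = f z * (neInd x z * (neInd y z * neInd w z))) :
    ∑ z, g z = ∑ z, f z - f x - f y - f w := by
  rw [← sum_mul_neInd_three f hxy hxw hyw]
  exact Finset.sum_congr rfl fun z _ => hg z

theorem sum_adjInd_mul_const (x : V) (c : ℚ) : ∑ y, adjInd G x y * c = deg G x * c := by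
  rw [deg, Finset.sum_mul]

/-- After an inner vertex is summed out, the dependence on a neighbour `z` of `x` is often only
through whether `z` is adjacent to `y`; such sums need only degree and codegree. -/
theorem sum_adjInd_mul_affine (x y : V) (c d : ℚ) :
    ∑ z, adjInd G x z * (c + d * adjInd G y z) = deg G x * c + codeg G x y * d := by
  rw [deg, codeg, Finset.sum_mul, Finset.sum_mul, ← Finset.sum_add_distrib]
  exact Finset.sum_congr rfl fun z _ => by ring

theorem sum_adjInd_pair_mul_const (x y : V) (c : ℚ) :
    ∑ z, adjInd G x z * (adjInd G y z * c) = codeg G x y * c := by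
  rw [codeg, Finset.sum_mul]
  exact Finset.sum_congr rfl fun z _ => by ring

theorem sum_adjInd_swap (F : V → V → ℚ) :
    ∑ x, ∑ y, adjInd G x y * F x y = ∑ x, ∑ y, adjInd G x y * F y x := by
  rw [Finset.sum_comm]
  simp only [adjInd_comm G]

theorem sum_codeg_pairs (x y : V) :
    ∑ z, adjInd G x z * (adjInd G y z * ∑ w, adjInd G x w * (adjInd G y w * neInd z w))
      = codeg G x y * (codeg G x y - 1) := by
  simpa only [mul_assoc, codeg] using
    sum_pairs (fun z => adjInd G x z * adjInd G y z) (adjInd_pair_idem G x y)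

theorem sum_codeg_triples (x y : V) :
    ∑ z, adjInd G x z * (adjInd G y z * ∑ w, adjInd G x w * (adjInd G y w * (neInd z w *
      ∑ u, adjInd G x u * (adjInd G y u * (neInd z u * neInd w u)))))
      = codeg G x y * (codeg G x y - 1) * (codeg G x y - 2) := by
  simpa only [mul_assoc, codeg] using
    sum_triples (fun z => adjInd G x z * adjInd G y z) (adjInd_pair_idem G x y)

theorem pathThree_count : 2 * (graphletCount 3 3 G : ℚ) = ∑ x, deg G x * (deg G x - 1) := by
  have h := graphletCount_three G 3 2 ![2, 0, 1] true true false
    (by decide) (by decide +kernel) (by decide +kernel)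
  exact h.trans (Finset.sum_congr rfl fun x _ => sum_pairs (adjInd G x) (adjInd_mul_self G x))

theorem triangle_count : 6 * (graphletCount 3 7 G : ℚ) = ∑ x, triWalks G x :=
  graphletCount_three G 7 6 ![0, 1, 2] true true true
    (by decide) (by decide +kernel) (by decide +kernel)

theorem starFour_count :
    6 * (graphletCount 4 11 G : ℚ) = ∑ x, deg G x * (deg G x - 1) * (deg G x - 2) := by
  have h := graphletCount_four G 11 6 ![3, 0, 1, 2] true true false true false false
    (by decide) (by decide +kernel) (by decide +kernel)
  exact h.trans (Finset.sum_congr rfl fun x _ => sum_triples (adjInd G x) (adjInd_mul_self G x))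

/-- The middle edge `x y` is placed first and extended at both ends; extensions that meet in one
vertex form triangles. -/
theorem pathFour_count : 2 * (graphletCount 4 13 G : ℚ)
    = ∑ x, ∑ y, adjInd G x y * ((deg G x - 1) * (deg G y - 1)) - ∑ x, triWalks G x := by
  have h := graphletCount_four G 13 2 ![2, 3, 1, 0] true true false false true false
    (by decide) (by decide +kernel) (by decide +kernel)
  refine h.trans ?_
  rw [← Finset.sum_sub_distrib]
  refine Finset.sum_congr rfl fun x _ => ?_
  rw [triWalks, ← Finset.sum_sub_distrib]
  refine Finset.sum_congr rfl fun y _ => ?_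
  rw [← mul_sub]
  refine adjInd_mul_congr fun hxy => ?_
  simp only [pairWeight]
  calc _ = ∑ z, adjInd G x z * (neInd y z * (deg G y - 1 + -1 * adjInd G y z)) := by
        refine Finset.sum_congr rfl fun z _ => adjInd_mul_congr fun hxz => neInd_mul_congr
          fun hyz => ?_
        rw [sum_eq_sub_two (adjInd G y) hxz.ne fun w => by ring, adjInd_of_adj hxy.symm, deg]
        ring
    _ = _ := by
        rw [sum_eq_sub_one (fun z => adjInd G x z * (deg G y - 1 + -1 * adjInd G y z)) (x := y)
          fun z => by ring, sum_adjInd_mul_affine, adjInd_of_adj hxy, adjInd_self]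
        ring

theorem paw_count :
    2 * (graphletCount 4 15 G : ℚ) = ∑ x, triWalks G x * (deg G x - 2) := by
  have h := graphletCount_four G 15 2 ![3, 1, 2, 0] true true true true false false
    (by decide) (by decide +kernel) (by decide +kernel)
  refine h.trans (Finset.sum_congr rfl fun x _ => ?_)
  simp only [pairWeight]
  rw [triWalks, Finset.sum_mul]
  refine Finset.sum_congr rfl fun y _ => ?_
  rw [mul_assoc, ← sum_adjInd_pair_mul_const]
  refine adjInd_mul_congr fun hxy => Finset.sum_congr rfl fun z _ => adjInd_mul_congr fun hxz =>
    adjInd_mul_congr fun hyz => ?_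
  rw [sum_mul_neInd_two _ hyz.ne, adjInd_of_adj hxy, adjInd_of_adj hxz, deg]
  ring

theorem cycleFour_count : 8 * (graphletCount 4 30 G : ℚ)
    = ∑ x, ∑ y, neInd x y * (codeg G x y * (codeg G x y - 1)) := by
  have h := graphletCount_four G 30 8 ![0, 1, 2, 3] false true true true true false
    (by decide) (by decide +kernel) (by decide +kernel)
  refine h.trans (Finset.sum_congr rfl fun x _ => Finset.sum_congr rfl fun y _ => ?_)
  rw [← sum_codeg_pairs]
  rfl

theorem diamond_count : 4 * (graphletCount 4 31 G : ℚ)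
    = ∑ x, ∑ y, adjInd G x y * (codeg G x y * (codeg G x y - 1)) := by
  have h := graphletCount_four G 31 4 ![2, 3, 0, 1] true true true true true false
    (by decide) (by decide +kernel) (by decide +kernel)
  refine h.trans (Finset.sum_congr rfl fun x _ => Finset.sum_congr rfl fun y _ => ?_)
  rw [← sum_codeg_pairs]
  rfl

theorem completeFour_count : 24 * (graphletCount 4 63 G : ℚ)
    = ∑ x, ∑ y, adjInd G x y * ∑ z, adjInd G x z * (adjInd G y z *
      ∑ w, adjInd G x w * (adjInd G y w * adjInd G z w)) :=
  graphletCount_four G 63 24 ![0, 1, 2, 3] true true true true true true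
    (by decide) (by decide +kernel) (by decide +kernel)

theorem starFive_count : 24 * (graphletCount 5 75 G : ℚ)
    = ∑ x, deg G x * (deg G x - 1) * (deg G x - 2) * (deg G x - 3) := by
  have h := graphletCount_five G 75 24 ![4, 0, 1, 2, 3] true true false true false false true
    false false false (by decide) (by decide +kernel) (by decide +kernel)
  exact h.trans (Finset.sum_congr rfl fun x _ => sum_quadruples (adjInd G x) (adjInd_mul_self G x))

theorem sum_adjInd_codeg_mul (f : V → ℚ) :
    ∑ x, ∑ y, adjInd G x y * (codeg G x y * f x) = ∑ x, triWalks G x * f x := by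
  refine Finset.sum_congr rfl fun x _ => ?_
  rw [triWalks, Finset.sum_mul]
  exact Finset.sum_congr rfl fun y _ => by ring

/-- `x` carries the two leaves and `y` is the middle of the long arm. The arm may end on a leaf,
which closes a triangle at `x`; removing these cases yields the paw term. -/
theorem arrow_count : 2 * (graphletCount 5 77 G : ℚ)
    = ∑ x, ∑ y, adjInd G x y * ((deg G x - 1) * (deg G x - 2) * (deg G y - 1))
      - 4 * (graphletCount 4 15 G : ℚ) := by
  have h := graphletCount_five G 77 2 ![4, 3, 0, 1, 2] true true false true false false false true
    false false (by decide) (by decide +kernel) (by decide +kernel)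
  rw [show 4 * (graphletCount 4 15 G : ℚ) = 2 * (2 * (graphletCount 4 15 G : ℚ)) by ring,
    paw_count, ← sum_adjInd_codeg_mul, Finset.mul_sum, ← Finset.sum_sub_distrib]
  refine h.trans (Finset.sum_congr rfl fun x _ => ?_)
  rw [Finset.mul_sum, ← Finset.sum_sub_distrib]
  refine Finset.sum_congr rfl fun y _ => ?_
  rw [mul_left_comm 2, ← mul_sub]
  refine adjInd_mul_congr fun hxy => ?_
  simp only [pairWeight]
  calc _ = ∑ z, adjInd G x z * (neInd y z * ((deg G y - 1) * (deg G x - 2) - codeg G x y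
          + (3 - deg G x) * adjInd G y z)) := by
        refine Finset.sum_congr rfl fun z _ => adjInd_mul_congr fun hxz => neInd_mul_congr
          fun hyz => ?_
        calc _ = ∑ w, adjInd G x w * (neInd y w * (neInd z w *
              (deg G y - 1 - adjInd G y z + -1 * adjInd G y w))) := by
              refine Finset.sum_congr rfl fun w _ => adjInd_mul_congr fun hxw => neInd_mul_congr
                fun hyw => neInd_mul_congr fun hzw => ?_
              rw [sum_eq_sub_three (adjInd G y) hxz.ne hxw.ne hzw fun w => by ring,
                adjInd_of_adj hxy.symm, deg]
              ring
          _ = _ := by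
              rw [sum_eq_sub_two (fun w => adjInd G x w *
                (deg G y - 1 - adjInd G y z + -1 * adjInd G y w)) hyz fun w => by ring,
                sum_adjInd_mul_affine, adjInd_of_adj hxy, adjInd_of_adj hxz, adjInd_self]
              ring
    _ = _ := by
        rw [sum_eq_sub_one (fun z => adjInd G x z * ((deg G y - 1) * (deg G x - 2) - codeg G x y
          + (3 - deg G x) * adjInd G y z)) (x := y) fun z => by ring, sum_adjInd_mul_affine,
          adjInd_of_adj hxy, adjInd_self]
        ring

theorem cricket_count : 4 * (graphletCount 5 79 G : ℚ)
    = ∑ x, triWalks G x * ((deg G x - 2) * (deg G x - 3)) := by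
  have h := graphletCount_five G 79 4 ![4, 2, 3, 0, 1] true true true true false false true
    false false false (by decide) (by decide +kernel) (by decide +kernel)
  refine h.trans (Finset.sum_congr rfl fun x _ => ?_)
  simp only [pairWeight]
  rw [triWalks, Finset.sum_mul]
  refine Finset.sum_congr rfl fun y _ => ?_
  rw [mul_assoc, ← sum_adjInd_pair_mul_const]
  refine adjInd_mul_congr fun hxy => Finset.sum_congr rfl fun z _ => adjInd_mul_congr fun hxz =>
    adjInd_mul_congr fun hyz => ?_
  calc _ = ∑ w, adjInd G x w * (neInd y w * (neInd z w * (deg G x - 3))) := by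
        refine Finset.sum_congr rfl fun w _ => adjInd_mul_congr fun hxw => neInd_mul_congr
          fun hyw => neInd_mul_congr fun hzw => ?_
        rw [sum_mul_neInd_three _ hyz.ne hyw hzw, adjInd_of_adj hxy, adjInd_of_adj hxz,
          adjInd_of_adj hxw, deg]
        ring
    _ = _ := by
        rw [sum_eq_sub_two (fun w => adjInd G x w * (deg G x - 3)) hyz.ne fun w => by ring,
          sum_adjInd_mul_const, adjInd_of_adj hxy, adjInd_of_adj hxz]
        ring

/-- Pendants are attached at the ends `x`, `y` of an edge of a triangle; if they coincide, the two
common neighbours of `x` and `y` make a diamond. -/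
theorem bull_count : 2 * (graphletCount 5 87 G : ℚ)
    = ∑ x, ∑ y, adjInd G x y * (codeg G x y * ((deg G x - 2) * (deg G y - 2)))
      - 4 * (graphletCount 4 31 G : ℚ) := by
  have h := graphletCount_five G 87 2 ![3, 4, 2, 1, 0] true true true true false false false true
    false false (by decide) (by decide +kernel) (by decide +kernel)
  rw [diamond_count, ← Finset.sum_sub_distrib]
  refine h.trans (Finset.sum_congr rfl fun x _ => ?_)
  rw [← Finset.sum_sub_distrib]
  refine Finset.sum_congr rfl fun y _ => ?_
  rw [← mul_sub, ← mul_sub, ← sum_adjInd_pair_mul_const]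
  refine adjInd_mul_congr fun hxy => Finset.sum_congr rfl fun z _ => adjInd_mul_congr fun hxz =>
    adjInd_mul_congr fun hyz => ?_
  simp only [pairWeight]
  calc _ = ∑ w, adjInd G x w * (neInd y w * (neInd z w *
          (deg G y - 2 + -1 * adjInd G y w))) := by
        refine Finset.sum_congr rfl fun w _ => adjInd_mul_congr fun hxw => neInd_mul_congr
          fun hyw => neInd_mul_congr fun hzw => ?_
        rw [sum_eq_sub_three (adjInd G y) hxz.ne hxw.ne hzw fun w => by ring,
          adjInd_of_adj hxy.symm, adjInd_of_adj hyz, deg]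
        ring
    _ = _ := by
        rw [sum_eq_sub_two (fun w => adjInd G x w * (deg G y - 2 + -1 * adjInd G y w)) hyz.ne
          fun w => by ring, sum_adjInd_mul_affine, adjInd_of_adj hxy, adjInd_of_adj hxz,
          adjInd_of_adj hyz, adjInd_self]
        ring

/-- `x` and `y` are opposite corners of the 4-cycle, with the pendant at `x`. The pendant must avoid
`y`, which costs a term exactly when `x` and `y` are adjacent, that is, when the cycle has this
chord. -/
theorem banner_count : 2 * (graphletCount 5 94 G : ℚ)
    = ∑ x, ∑ y, neInd x y * (codeg G x y * (codeg G x y - 1) * (deg G x - 2))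
      - 4 * (graphletCount 4 31 G : ℚ) := by
  have h := graphletCount_five G 94 2 ![4, 3, 1, 2, 0] false true true true true false true
    false false false (by decide) (by decide +kernel) (by decide +kernel)
  rw [diamond_count, ← Finset.sum_sub_distrib]
  refine h.trans (Finset.sum_congr rfl fun x _ => ?_)
  rw [← Finset.sum_sub_distrib]
  refine Finset.sum_congr rfl fun y _ => ?_
  -- The diamond term is also supported on `x ≠ y`, so both terms share the factor `neInd x y`.
  rw [← adjInd_mul_neInd, mul_comm (adjInd G x y), mul_assoc (neInd x y), ← mul_sub]
  refine neInd_mul_congr fun hxy => ?_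
  rw [mul_comm (adjInd G x y), ← mul_sub, ← sum_codeg_pairs, Finset.sum_mul]
  simp only [pairWeight, mul_assoc, Finset.sum_mul]
  refine Finset.sum_congr rfl fun z _ => adjInd_mul_congr fun hxz => adjInd_mul_congr fun hyz =>
    Finset.sum_congr rfl fun w _ => adjInd_mul_congr fun hxw => adjInd_mul_congr fun hyw =>
    neInd_mul_congr fun hzw => ?_
  rw [sum_mul_neInd_three _ hyz.ne hyw.ne hzw, adjInd_of_adj hxz, adjInd_of_adj hxw, deg]
  ring

theorem stingray_count : 2 * (graphletCount 5 95 G : ℚ)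
    = ∑ x, ∑ y, adjInd G x y * (codeg G x y * (codeg G x y - 1) * (deg G x - 3)) := by
  have h := graphletCount_five G 95 2 ![4, 3, 1, 2, 0] true true true true true false true
    false false false (by decide) (by decide +kernel) (by decide +kernel)
  refine h.trans (Finset.sum_congr rfl fun x _ => Finset.sum_congr rfl fun y _ =>
    adjInd_mul_congr fun hxy => ?_)
  rw [← sum_codeg_pairs, Finset.sum_mul]
  simp only [pairWeight, mul_assoc, Finset.sum_mul]
  refine Finset.sum_congr rfl fun z _ => adjInd_mul_congr fun hxz => adjInd_mul_congr fun hyz =>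
    Finset.sum_congr rfl fun w _ => adjInd_mul_congr fun hxw => adjInd_mul_congr fun hyw =>
    neInd_mul_congr fun hzw => ?_
  rw [sum_mul_neInd_three _ hyz.ne hyw.ne hzw, adjInd_of_adj hxy, adjInd_of_adj hxz,
    adjInd_of_adj hxw, deg]
  ring

theorem ufo_count : 12 * (graphletCount 5 222 G : ℚ) = ∑ x, ∑ y, neInd x y *
    (codeg G x y * (codeg G x y - 1) * (codeg G x y - 2)) := by
  have h := graphletCount_five G 222 12 ![3, 4, 0, 1, 2] false true true true true false true true
    false false (by decide) (by decide +kernel) (by decide +kernel)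
  refine h.trans (Finset.sum_congr rfl fun x _ => Finset.sum_congr rfl fun y _ => ?_)
  rw [← sum_codeg_triples]
  rfl

theorem chevron_count : 12 * (graphletCount 5 223 G : ℚ) = ∑ x, ∑ y, adjInd G x y *
    (codeg G x y * (codeg G x y - 1) * (codeg G x y - 2)) := by
  have h := graphletCount_five G 223 12 ![3, 4, 0, 1, 2] true true true true true false true true
    false false (by decide) (by decide +kernel) (by decide +kernel)
  refine h.trans (Finset.sum_congr rfl fun x _ => Finset.sum_congr rfl fun y _ => ?_)
  rw [← sum_codeg_triples]
  rfl

/-- The pendant sits at `z`, one of two common neighbours `z`, `w` of the edge `x y`. It must avoid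
`w`, which matters only if `z` and `w` are adjacent, and then the four vertices form a complete
graph. -/
theorem spinningTop_count : 2 * (graphletCount 5 119 G : ℚ)
    = ∑ x, ∑ y, adjInd G x y * ∑ z, adjInd G x z * (adjInd G y z *
      ((codeg G x y - 1) * (deg G z - 2))) - 24 * (graphletCount 4 63 G : ℚ) := by
  have h := graphletCount_five G 119 2 ![2, 3, 4, 1, 0] true true true true true false false false
    true false (by decide) (by decide +kernel) (by decide +kernel)
  rw [completeFour_count]
  simp only [← Finset.sum_sub_distrib, ← mul_sub]
  refine h.trans (Finset.sum_congr rfl fun x _ => Finset.sum_congr rfl fun y _ =>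
    adjInd_mul_congr fun hxy => Finset.sum_congr rfl fun z _ => adjInd_mul_congr fun hxz =>
    adjInd_mul_congr fun hyz => ?_)
  simp only [pairWeight]
  calc _ = ∑ w, adjInd G x w * (adjInd G y w * (neInd z w * (deg G z - 2 - adjInd G z w))) := by
        refine Finset.sum_congr rfl fun w _ => adjInd_mul_congr fun hxw => adjInd_mul_congr
          fun hyw => neInd_mul_congr fun hzw => ?_
        rw [sum_eq_sub_three (adjInd G z) hxy.ne hxw.ne hyw.ne fun w => by ring,
          adjInd_of_adj hxz.symm, adjInd_of_adj hyz.symm, deg]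
        ring
    _ = _ := by
        rw [sum_eq_sub_one (fun w => adjInd G x w * (adjInd G y w *
          (deg G z - 2 - adjInd G z w))) (x := z) fun w => by ring, adjInd_self,
          adjInd_of_adj hxz, adjInd_of_adj hyz]
        simp only [mul_sub, Finset.sum_sub_distrib, sum_adjInd_pair_mul_const]
        ring

theorem envelope_count : 4 * (graphletCount 5 254 G : ℚ)
    = ∑ x, ∑ y, adjInd G x y * ∑ z, adjInd G x z * (adjInd G y z *
      ∑ w, adjInd G x w * (adjInd G y w * (neInd z w * (codeg G z w - 2)))) := by
  have h := graphletCount_five G 254 4 ![1, 2, 3, 4, 0] true true true true true false false false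
    true true (by decide) (by decide +kernel) (by decide +kernel)
  refine h.trans (Finset.sum_congr rfl fun x _ => Finset.sum_congr rfl fun y _ =>
    adjInd_mul_congr fun hxy => Finset.sum_congr rfl fun z _ => adjInd_mul_congr fun hxz =>
    adjInd_mul_congr fun hyz => Finset.sum_congr rfl fun w _ => adjInd_mul_congr fun hxw =>
    adjInd_mul_congr fun hyw => neInd_mul_congr fun hzw => ?_)
  simp only [pairWeight]
  rw [sum_eq_sub_two (fun u => adjInd G z u * adjInd G w u) hxy.ne fun u => by ring,
    adjInd_of_adj hxz.symm, adjInd_of_adj hyz.symm, adjInd_of_adj hxw.symm,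
    adjInd_of_adj hyw.symm, codeg]
  ring

theorem sum_adjInd_mul_adjInd (x y : V) : ∑ z, adjInd G x z * adjInd G y z = codeg G x y := rfl

theorem sum_adjInd_codeg_sq : ∑ x, ∑ y, adjInd G x y * (codeg G x y * codeg G x y)
    = 4 * (graphletCount 4 31 G : ℚ) + 6 * (graphletCount 3 7 G : ℚ) := by
  rw [diamond_count, triangle_count, ← Finset.sum_add_distrib]
  refine Finset.sum_congr rfl fun x _ => ?_
  rw [triWalks, ← Finset.sum_add_distrib]
  exact Finset.sum_congr rfl fun y _ => by ring

theorem sum_triWalks_mul_deg : ∑ x, triWalks G x * deg G x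
    = 2 * (graphletCount 4 15 G : ℚ) + 12 * (graphletCount 3 7 G : ℚ) := by
  rw [show (12 : ℚ) * graphletCount 3 7 G = 2 * (6 * graphletCount 3 7 G) by ring, paw_count,
    triangle_count, Finset.mul_sum, ← Finset.sum_add_distrib]
  exact Finset.sum_congr rfl fun y _ => by ring

/-- The sum of `f` over the labelled triangles. -/
def triangleSum (f : V → V → V → ℚ) : ℚ :=
  ∑ x, ∑ y, adjInd G x y * ∑ z, adjInd G x z * (adjInd G y z * f x y z)

theorem triangleSum_add (f g : V → V → V → ℚ) :
    triangleSum G (fun x y z => f x y z + g x y z) = triangleSum G f + triangleSum G g := by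
  simp only [triangleSum, mul_add, Finset.sum_add_distrib]

theorem triangleSum_smul (c : ℚ) (f : V → V → V → ℚ) :
    triangleSum G (fun x y z => c * f x y z) = c * triangleSum G f := by
  simp only [triangleSum, mul_left_comm _ c, Finset.mul_sum]

/-- The two transpositions generate all relabellings of a triangle, so a degree or codegree
correction has the same total at whichever corner or side it arises. -/
theorem triangleSum_swap_left (f : V → V → V → ℚ) :
    triangleSum G (fun x y z => f y x z) = triangleSum G f := by
  rw [triangleSum, sum_adjInd_swap]
  simp only [triangleSum, mul_left_comm]

theorem triangleSum_swap_right (f : V → V → V → ℚ) :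
    triangleSum G (fun x y z => f x z y) = triangleSum G f := by
  refine Finset.sum_congr rfl fun x _ => ?_
  simp only [Finset.mul_sum]
  rw [Finset.sum_comm]
  refine Finset.sum_congr rfl fun y _ => Finset.sum_congr rfl fun z _ => ?_
  rw [adjInd_comm G z y]
  ring

theorem triangleSum_pair (f : V → V → ℚ) :
    triangleSum G (fun x y _ => f x y) = ∑ x, ∑ y, adjInd G x y * (codeg G x y * f x y) := by
  simp only [triangleSum, sum_adjInd_pair_mul_const]

theorem triangleSum_fst (f : V → ℚ) :
    triangleSum G (fun x _ _ => f x) = ∑ x, triWalks G x * f x := by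
  rw [triangleSum_pair, sum_adjInd_codeg_mul]

theorem triangleSum_snd (f : V → ℚ) :
    triangleSum G (fun _ y _ => f y) = ∑ x, triWalks G x * f x := by
  rw [← triangleSum_fst]
  exact triangleSum_swap_left G fun x _ _ => f x

theorem triangleSum_thd (f : V → ℚ) :
    triangleSum G (fun _ _ z => f z) = ∑ x, triWalks G x * f x := by
  rw [← triangleSum_snd]
  exact triangleSum_swap_right G fun _ y _ => f y

theorem triangleSum_codeg : triangleSum G (fun x y _ => codeg G x y)
    = 4 * (graphletCount 4 31 G : ℚ) + 6 * (graphletCount 3 7 G : ℚ) := by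
  rw [triangleSum_pair, sum_adjInd_codeg_sq]

theorem triangleSum_codeg' : triangleSum G (fun x _ z => codeg G x z)
    = 4 * (graphletCount 4 31 G : ℚ) + 6 * (graphletCount 3 7 G : ℚ) := by
  rw [← triangleSum_codeg]
  exact triangleSum_swap_right G fun x y _ => codeg G x y

theorem triangleSum_codeg'' : triangleSum G (fun _ y z => codeg G y z)
    = 4 * (graphletCount 4 31 G : ℚ) + 6 * (graphletCount 3 7 G : ℚ) := by
  rw [← triangleSum_codeg']
  exact triangleSum_swap_left G fun x _ z => codeg G x z

theorem triangleSum_const (c : ℚ) :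
    triangleSum G (fun _ _ _ => c) = c * (6 * (graphletCount 3 7 G : ℚ)) := by
  rw [triangle_count, triangleSum_fst G fun _ => c, ← Finset.sum_mul, mul_comm]

theorem lollipop_count : 2 * (graphletCount 5 117 G : ℚ)
    = ∑ x, triWalks G x * ∑ y, adjInd G x y * (deg G y - 1)
      - 12 * (graphletCount 3 7 G : ℚ) - 4 * (graphletCount 4 15 G : ℚ)
      - 8 * (graphletCount 4 31 G : ℚ) := by
  have h := graphletCount_five G 117 2 ![3, 1, 2, 4, 0] true true true true false false false false
    false true (by decide) (by decide +kernel) (by decide +kernel)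
  -- The path `x`, `w`, `u` hangs off the triangle at `x`. The codegree terms exclude `u` equal to
  -- `y` or `z`; the degree terms exclude `w` equal to `y` or `z`, each leaving a constant 2.
  have h2 : 2 * (graphletCount 5 117 G : ℚ) = triangleSum G (fun x y z =>
      (∑ w, adjInd G x w * (deg G w - 1)) + (-1 * codeg G x y + (-1 * codeg G x z +
      (-1 * deg G y + (-1 * deg G z + 4))))) := by
    refine h.trans (Finset.sum_congr rfl fun x _ => Finset.sum_congr rfl fun y _ =>
      adjInd_mul_congr fun hxy => Finset.sum_congr rfl fun z _ => adjInd_mul_congr fun hxz =>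
      adjInd_mul_congr fun hyz => ?_)
    simp only [pairWeight]
    calc _ = ∑ w, adjInd G x w * (neInd y w * (neInd z w *
            (deg G w - 1 - adjInd G y w - adjInd G z w))) := by
          refine Finset.sum_congr rfl fun w _ => adjInd_mul_congr fun hxw => neInd_mul_congr
            fun hyw => neInd_mul_congr fun hzw => ?_
          rw [sum_eq_sub_three (adjInd G w) hxy.ne hxz.ne hyz.ne fun w => by ring,
            adjInd_of_adj hxw.symm, deg, adjInd_comm G w y, adjInd_comm G w z]
      _ = _ := by
          rw [sum_eq_sub_two (fun w => adjInd G x w *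
            (deg G w - 1 - adjInd G y w - adjInd G z w)) hyz.ne fun w => by ring,
            adjInd_of_adj hxy, adjInd_of_adj hxz, adjInd_of_adj hyz, adjInd_of_adj hyz.symm]
          simp only [mul_sub, Finset.sum_sub_distrib, adjInd_self, codeg]
          ring
  rw [h2]
  simp only [triangleSum_add, triangleSum_smul, triangleSum_const]
  simp only [triangleSum_fst, triangleSum_codeg, triangleSum_codeg', triangleSum_snd,
    triangleSum_thd, sum_triWalks_mul_deg]
  ring

theorem hourglass_count : 8 * (graphletCount 5 235 G : ℚ)
    = ∑ x, triWalks G x * (triWalks G x - 2) - 16 * (graphletCount 4 31 G : ℚ) := by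
  have h := graphletCount_five G 235 8 ![4, 0, 3, 1, 2] true true true true false false true false
    false true (by decide) (by decide +kernel) (by decide +kernel)
  -- The second triangle at `x` must avoid `y` and `z`. The constant 4 restores the two orientations
  -- of the triangle `x y z` itself, which the two codegree terms each remove; in the total the
  -- triangle counts cancel.
  have h2 : 8 * (graphletCount 5 235 G : ℚ) = triangleSum G (fun x y z =>
      triWalks G x - 2 + (-2 * codeg G x y + (-2 * codeg G x z + 4))) := by
    refine h.trans (Finset.sum_congr rfl fun x _ => Finset.sum_congr rfl fun y _ =>
      adjInd_mul_congr fun hxy => Finset.sum_congr rfl fun z _ => adjInd_mul_congr fun hxz =>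
      adjInd_mul_congr fun hyz => ?_)
    simp only [pairWeight]
    calc _ = ∑ w, adjInd G x w * (neInd y w * (neInd z w *
            (codeg G x w - adjInd G y w - adjInd G z w))) := by
          refine Finset.sum_congr rfl fun w _ => adjInd_mul_congr fun hxw => neInd_mul_congr
            fun hyw => neInd_mul_congr fun hzw => ?_
          rw [sum_eq_sub_two (fun u => adjInd G x u * adjInd G w u) hyz.ne fun w => by ring,
            adjInd_of_adj hxy, adjInd_of_adj hxz, codeg, adjInd_comm G w y, adjInd_comm G w z]
          ring
      _ = _ := by
          rw [sum_eq_sub_two (fun w => adjInd G x w *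
            (codeg G x w - adjInd G y w - adjInd G z w)) hyz.ne fun w => by ring,
            adjInd_of_adj hxy, adjInd_of_adj hxz, adjInd_of_adj hyz, adjInd_of_adj hyz.symm]
          simp only [mul_sub, Finset.sum_sub_distrib, adjInd_self, triWalks]
          simp only [sum_adjInd_mul_adjInd]
          ring
  rw [h2]
  simp only [triangleSum_add, triangleSum_smul, triangleSum_const]
  simp only [triangleSum_fst, triangleSum_codeg, triangleSum_codeg']
  ring

/-- `z` is the roof over `x y`, and the square is closed by a walk of length three from `x` to `y`.
The corrections exclude the walks that pass through `z` or return to `x` or `y`. -/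
theorem house_count : 2 * (graphletCount 5 237 G : ℚ)
    = ∑ x, ∑ y, adjInd G x y * ((∑ z, adjInd G x z * codeg G z y) * codeg G x y)
      - 18 * (graphletCount 3 7 G : ℚ) - 4 * (graphletCount 4 15 G : ℚ)
      - 8 * (graphletCount 4 31 G : ℚ) := by
  have h := graphletCount_five G 237 2 ![3, 4, 0, 2, 1] true true true true false false false true
    false true (by decide) (by decide +kernel) (by decide +kernel)
  have h2 : 2 * (graphletCount 5 237 G : ℚ) = triangleSum G (fun x y z =>
      (∑ w, adjInd G x w * codeg G w y) + (-1 * codeg G x z + (-1 * codeg G y z +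
      (-1 * deg G x + (-1 * deg G y + 3))))) := by
    refine h.trans (Finset.sum_congr rfl fun x _ => Finset.sum_congr rfl fun y _ =>
      adjInd_mul_congr fun hxy => Finset.sum_congr rfl fun z _ => adjInd_mul_congr fun hxz =>
      adjInd_mul_congr fun hyz => ?_)
    simp only [pairWeight]
    calc _ = ∑ w, adjInd G x w * (neInd y w * (neInd z w *
            (codeg G w y - 1 - adjInd G z w))) := by
          refine Finset.sum_congr rfl fun w _ => adjInd_mul_congr fun hxw => neInd_mul_congr
            fun hyw => neInd_mul_congr fun hzw => ?_
          rw [sum_eq_sub_two (fun u => adjInd G w u * adjInd G y u) hxz.ne fun w => by ring,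
            adjInd_of_adj hxy.symm, adjInd_of_adj hyz, adjInd_of_adj hxw.symm, codeg,
            adjInd_comm G w z]
          ring
      _ = _ := by
          rw [sum_eq_sub_two (fun w => adjInd G x w *
            (codeg G w y - 1 - adjInd G z w)) hyz.ne fun w => by ring,
            adjInd_of_adj hxy, adjInd_of_adj hxz, adjInd_of_adj hyz.symm, codeg_comm G z y]
          simp only [mul_sub, Finset.sum_sub_distrib, adjInd_self, codeg_self, sum_adjInd_mul_const]
          simp only [sum_adjInd_mul_adjInd]
          ring
  rw [h2]
  simp only [triangleSum_add, triangleSum_smul, triangleSum_const]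
  simp only [triangleSum_fst, triangleSum_codeg', triangleSum_codeg'', triangleSum_snd,
    sum_triWalks_mul_deg]
  rw [triangleSum_pair]
  simp only [mul_comm (codeg G _ _) (∑ w, _)]
  ring

theorem sum_codeg_right (x : V) : ∑ y, codeg G x y = ∑ y, adjInd G x y * deg G y := by
  simp only [codeg, deg, Finset.mul_sum]
  rw [Finset.sum_comm]
  exact Finset.sum_congr rfl fun y _ => Finset.sum_congr rfl fun z _ => by
    rw [adjInd_comm G z y]

theorem sum_codeg_mul (x : V) (f : V → ℚ) :
    ∑ y, codeg G x y * f y = ∑ y, adjInd G x y * ∑ z, adjInd G y z * f z := by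
  simp only [codeg, Finset.mul_sum, Finset.sum_mul]
  rw [Finset.sum_comm]
  exact Finset.sum_congr rfl fun y _ => Finset.sum_congr rfl fun z _ => by
    rw [adjInd_comm G z y, mul_assoc]

theorem sum_adjInd_symm_mul (f g : V → ℚ) :
    ∑ x, f x * ∑ y, adjInd G x y * g y = ∑ x, g x * ∑ y, adjInd G x y * f y := by
  simp only [Finset.mul_sum]
  rw [Finset.sum_comm]
  exact Finset.sum_congr rfl fun y _ => Finset.sum_congr rfl fun z _ => by
    rw [adjInd_comm G z y]; ring

theorem sum_adjInd_codeg_symm (x y : V) :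
    ∑ z, adjInd G x z * codeg G z y = ∑ z, adjInd G y z * codeg G z x := by
  simp only [codeg, Finset.mul_sum]
  rw [Finset.sum_comm]
  exact Finset.sum_congr rfl fun z _ => Finset.sum_congr rfl fun w _ => by
    rw [adjInd_comm G z w]; ring

/-- A closed walk of length five that is not a 5-cycle goes round a triangle with one backtracking
step. Its support is a triangle (30 walks each) or a paw (10 walks each). -/
theorem cycleFive_count : 10 * (graphletCount 5 236 G : ℚ)
    = ∑ x, ∑ y, (∑ z, adjInd G x z * codeg G z y) * codeg G y x
      - 30 * (graphletCount 3 7 G : ℚ) - 10 * (graphletCount 4 15 G : ℚ) := by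
  have h := graphletCount_five G 236 10 ![0, 3, 2, 1, 4] true false true false false true true
    false false true (by decide) (by decide +kernel) (by decide +kernel)
  have h2 : 10 * (graphletCount 5 236 G : ℚ) = ∑ x, ∑ y, adjInd G x y *
      ((∑ z, adjInd G y z * ((∑ w, adjInd G z w * codeg G w x) - codeg G y z - codeg G x y
        - adjInd G x z * (deg G x + deg G z - 3))) - triWalks G x + 2 * codeg G x y) := by
    refine h.trans (Finset.sum_congr rfl fun x _ => Finset.sum_congr rfl fun y _ =>
      adjInd_mul_congr fun hxy => ?_)
    simp only [pairWeight]
    calc _ = ∑ z, neInd x z * (adjInd G y z * ((∑ w, adjInd G z w * codeg G w x) - codeg G y z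
          - codeg G x y - adjInd G x z * (deg G x + deg G z - 3))) := by
          refine Finset.sum_congr rfl fun z _ => neInd_mul_congr fun hxz => adjInd_mul_congr
            fun hyz => ?_
          calc _ = ∑ w, neInd x w * (neInd y w * (adjInd G z w *
                (codeg G w x - adjInd G y w - adjInd G x z))) := by
                refine Finset.sum_congr rfl fun w _ => neInd_mul_congr fun hxw => neInd_mul_congr
                  fun hyw => adjInd_mul_congr fun hzw => ?_
                rw [sum_eq_sub_two (fun u => adjInd G w u * adjInd G x u) hyz.ne
                  fun w => by ring, adjInd_of_adj hxy, adjInd_of_adj hzw.symm, codeg,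
                  adjInd_comm G w y]
                ring
            _ = _ := by
                rw [sum_eq_sub_two (fun w => adjInd G z w *
                  (codeg G w x - adjInd G y w - adjInd G x z)) hxy.ne fun w => by ring]
                simp only [mul_sub, Finset.sum_sub_distrib, adjInd_self, codeg_self,
                  sum_adjInd_mul_const, sum_adjInd_mul_adjInd, adjInd_of_adj hxy.symm,
                  adjInd_of_adj hyz.symm, adjInd_comm G z x, codeg_comm G z y, codeg_comm G y x,
                  adjInd_mul_self]
                ring
      _ = _ := by
          rw [sum_eq_sub_one (fun z => adjInd G y z * ((∑ w, adjInd G z w * codeg G w x)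
            - codeg G y z - codeg G x y - adjInd G x z * (deg G x + deg G z - 3))) (x := x)
            fun w => by ring, adjInd_of_adj hxy.symm, adjInd_self, codeg_comm G y x]
          simp only [codeg_comm G _ x]
          rw [triWalks]
          ring
  -- The unrestricted part of the nested sum is the number of closed walks of length five.
  have h3 : ∑ x, ∑ y, adjInd G x y * ∑ z, adjInd G y z * ∑ w, adjInd G z w * codeg G w x
      = ∑ x, ∑ y, (∑ z, adjInd G x z * codeg G z y) * codeg G y x := by
    refine Finset.sum_congr rfl fun x _ => ?_
    rw [← sum_codeg_mul]
    exact Finset.sum_congr rfl fun y _ => by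
      rw [sum_adjInd_codeg_symm G x y, codeg_comm G x y, mul_comm]
  have h4 : ∑ x, ∑ y, adjInd G x y * triWalks G y = ∑ x, triWalks G x * deg G x := by
    rw [sum_adjInd_swap]
    simp only [sum_adjInd_mul_const, mul_comm (deg G _)]
  have h5 : ∑ x, ∑ y, adjInd G x y * triWalks G x = ∑ x, triWalks G x * deg G x := by
    simp only [sum_adjInd_mul_const, mul_comm (deg G _)]
  have h6 : ∑ x, ∑ y, adjInd G x y * (codeg G x y * deg G y) = ∑ x, triWalks G x * deg G x := by
    rw [← triangleSum_pair, triangleSum_snd]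
  have h7 : triangleSum G (fun x _ z => deg G x + (deg G z + -3))
      = 2 * ∑ x, triWalks G x * deg G x - 18 * (graphletCount 3 7 G : ℚ) := by
    simp only [triangleSum_add, triangleSum_const]
    simp only [triangleSum_fst, triangleSum_thd]
    ring
  have h8 : ∑ x, ∑ y, adjInd G x y * codeg G x y = 6 * (graphletCount 3 7 G : ℚ) :=
    (triangle_count G).symm
  have h9 : 10 * (graphletCount 5 236 G : ℚ)
      = ∑ x, ∑ y, adjInd G x y * ∑ z, adjInd G y z * ∑ w, adjInd G z w * codeg G w x
        - ∑ x, ∑ y, adjInd G x y * triWalks G y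
        - ∑ x, ∑ y, adjInd G x y * (codeg G x y * deg G y)
        - triangleSum G (fun x _ z => deg G x + (deg G z + -3))
        - ∑ x, ∑ y, adjInd G x y * triWalks G x
        + 2 * ∑ x, ∑ y, adjInd G x y * codeg G x y := by
    rw [h2, triangleSum]
    simp only [Finset.mul_sum _ _ (2 : ℚ), ← Finset.sum_sub_distrib, ← Finset.sum_add_distrib]
    refine Finset.sum_congr rfl fun x _ => Finset.sum_congr rfl fun y _ => ?_
    have h10 : ∑ z, adjInd G x z * (adjInd G y z * (deg G x + (deg G z + -3)))
        = ∑ z, adjInd G y z * (adjInd G x z * (deg G x + deg G z - 3)) :=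
      Finset.sum_congr rfl fun z _ => by ring
    rw [h10, triWalks, triWalks]
    simp only [mul_sub (adjInd G y _), Finset.sum_sub_distrib, sum_adjInd_mul_const]
    ring
  rw [h9, h3, h4, h5, h6, h7, h8, sum_triWalks_mul_deg]
  ring

theorem sum_neInd_mul (F : V → V → ℚ) :
    ∑ x, ∑ y, neInd x y * F x y = ∑ x, ∑ y, F x y - ∑ x, F x x := by
  rw [← Finset.sum_sub_distrib]
  exact Finset.sum_congr rfl fun x _ => sum_eq_sub_one (F x) fun y => mul_comm _ _

/-- The path is `w, x, z, y, u` with middle `z`. The number of extensions `w`, `u` does not depend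
on `z`, so summing over `z` gives a factor `codeg G x y`. -/
theorem pathFive_count_codeg : 2 * (graphletCount 5 86 G : ℚ)
    = ∑ x, ∑ y, neInd x y * (codeg G x y * ((deg G x - 1) * (deg G y - 1)
      - (codeg G x y - 1) - adjInd G x y * (deg G x + deg G y - 3))) := by
  have h := graphletCount_five G 86 2 ![3, 4, 2, 1, 0] false true true true false false false true
    false false (by decide) (by decide +kernel) (by decide +kernel)
  refine h.trans (Finset.sum_congr rfl fun x _ => Finset.sum_congr rfl fun y _ =>
    neInd_mul_congr fun hxy => ?_)
  rw [← sum_adjInd_pair_mul_const]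
  refine Finset.sum_congr rfl fun z _ => adjInd_mul_congr fun hxz => adjInd_mul_congr
    fun hyz => ?_
  simp only [pairWeight]
  calc _ = ∑ w, adjInd G x w * (neInd y w * (neInd z w *
          (deg G y - 1 - adjInd G x y + -1 * adjInd G y w))) := by
        refine Finset.sum_congr rfl fun w _ => adjInd_mul_congr fun hxw => neInd_mul_congr
          fun hyw => neInd_mul_congr fun hzw => ?_
        rw [sum_eq_sub_three (adjInd G y) hxz.ne hxw.ne hzw fun w => by ring,
          adjInd_of_adj hyz, adjInd_comm G y x, deg]
        ring
    _ = _ := by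
        rw [sum_eq_sub_two (fun w => adjInd G x w *
          (deg G y - 1 - adjInd G x y + -1 * adjInd G y w)) hyz.ne fun w => by ring,
          sum_adjInd_mul_affine, adjInd_of_adj hxz, adjInd_of_adj hyz, adjInd_self]
        linear_combination adjInd_mul_self G x y

/-- Walks of length four with distinct ends are compared with paths. Both sides reduce to degrees,
numbers of 2-walks and triangle sums; the trace of the fourth power occurs on both sides and cancels
without being evaluated. -/
theorem pathFive_count : 2 * (graphletCount 5 86 G : ℚ)
    = ∑ x, ∑ y, neInd x y * ∑ z, codeg G x z * codeg G z y
      - 4 * (graphletCount 3 3 G : ℚ) - 18 * (graphletCount 3 7 G : ℚ)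
      - 6 * (graphletCount 4 11 G : ℚ) - 4 * (graphletCount 4 13 G : ℚ)
      - 4 * (graphletCount 4 15 G : ℚ) := by
  -- `N x` is the number of walks of length two from `x`.
  let N : V → ℚ := fun x => ∑ y, adjInd G x y * deg G y
  have hN : ∀ x, ∑ y, codeg G x y = N x := sum_codeg_right G
  have hN' : ∀ x, ∑ y, adjInd G x y * (deg G y - 1) = N x - deg G x := fun x => by
    simp only [mul_sub, Finset.sum_sub_distrib, mul_one]
    rfl
  have hsum : ∑ x, N x = ∑ x, deg G x * deg G x := by
    change ∑ x, ∑ y, adjInd G x y * deg G y = _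
    rw [sum_adjInd_swap]
    simp only [sum_adjInd_mul_const]
  have hwalk : ∑ x, ∑ y, ∑ z, codeg G x z * codeg G z y = ∑ x, N x * N x := by
    calc _ = ∑ x, ∑ z, codeg G x z * N z := by
          refine Finset.sum_congr rfl fun x _ => ?_
          rw [Finset.sum_comm]
          simp only [← Finset.mul_sum, hN]
      _ = ∑ x, N x * N x := by
          rw [Finset.sum_comm]
          simp only [← Finset.sum_mul, codeg_comm G _, hN]
  have hdeg : ∑ x, ∑ y, codeg G x y * ((deg G x - 1) * (deg G y - 1))
      = ∑ x, (N x - deg G x) * (N x - deg G x) := by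
    calc _ = ∑ x, (deg G x - 1) * ∑ y, adjInd G x y * (N y - deg G y) := by
          refine Finset.sum_congr rfl fun x _ => ?_
          simp only [← hN']
          rw [← sum_codeg_mul, Finset.mul_sum]
          exact Finset.sum_congr rfl fun y _ => by ring
      _ = _ := by
          rw [sum_adjInd_symm_mul]
          simp only [hN']
  have hpath : 2 * (graphletCount 4 13 G : ℚ)
      = ∑ x, (deg G x - 1) * (N x - deg G x) - 6 * (graphletCount 3 7 G : ℚ) := by
    rw [pathFour_count, triangle_count]
    congr 1
    refine Finset.sum_congr rfl fun x _ => ?_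
    rw [← hN', Finset.mul_sum]
    exact Finset.sum_congr rfl fun y _ => by ring
  have htri : ∑ x, ∑ y, adjInd G x y * (codeg G x y * (deg G x + (deg G y + -3)))
      = 2 * ∑ x, triWalks G x * deg G x - 18 * (graphletCount 3 7 G : ℚ) := by
    rw [← triangleSum_pair]
    simp only [triangleSum_add, triangleSum_const]
    simp only [triangleSum_fst, triangleSum_snd]
    ring
  have hsplit : 2 * (graphletCount 5 86 G : ℚ)
      = ∑ x, ∑ y, neInd x y * (codeg G x y * ((deg G x - 1) * (deg G y - 1)))
        - ∑ x, ∑ y, neInd x y * (codeg G x y * (codeg G x y - 1))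
        - ∑ x, ∑ y, adjInd G x y * (codeg G x y * (deg G x + (deg G y + -3))) := by
    rw [pathFive_count_codeg]
    simp only [← Finset.sum_sub_distrib]
    refine Finset.sum_congr rfl fun x _ => Finset.sum_congr rfl fun y _ => ?_
    linear_combination (-(codeg G x y * (deg G x + deg G y - 3))) * adjInd_mul_neInd G x y
  have hdiag : ∑ x, ∑ y, codeg G x y * (codeg G x y - 1)
      = ∑ x, ∑ z, codeg G x z * codeg G z x - ∑ x, N x := by
    rw [← Finset.sum_sub_distrib]
    refine Finset.sum_congr rfl fun x _ => ?_
    rw [← hN, ← Finset.sum_sub_distrib]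
    exact Finset.sum_congr rfl fun y _ => by rw [codeg_comm G y x]; ring
  -- Termwise this is a polynomial identity in `N x` and `deg G x`; the surplus `N x` and squared
  -- degree terms are exchanged by `hsum` at the end.
  have hS : ∑ x, (N x - deg G x) * (N x - deg G x) - ∑ x, deg G x * ((deg G x - 1) * (deg G x - 1))
      + ∑ x, N x + ∑ x, deg G x * (deg G x - 1)
      = ∑ x, N x * N x - 2 * ∑ x, deg G x * (deg G x - 1)
      - ∑ x, deg G x * (deg G x - 1) * (deg G x - 2) - 2 * ∑ x, (deg G x - 1) * (N x - deg G x)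
      - ∑ x, N x + ∑ x, deg G x * deg G x := by
    simp only [Finset.mul_sum _ _ (2 : ℚ), ← Finset.sum_sub_distrib, ← Finset.sum_add_distrib]
    exact Finset.sum_congr rfl fun x _ => by ring
  rw [hsplit, sum_neInd_mul, sum_neInd_mul, sum_neInd_mul, htri, sum_triWalks_mul_deg, hdeg,
    hwalk, hdiag]
  simp only [codeg_self]
  have h1 := pathThree_count G
  have h2 := starFour_count G
  linear_combination hS - hsum + 2 * h1 + h2 + 2 * hpath

end LabelledCounts

/-! ### Graphlets with a dominating vertex, counted in neighbourhoods -/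

section Cones

variable {V : Type*} [DecidableEq V] [Fintype V] (G : SimpleGraph V) [DecidableRel G.Adj]

theorem pairWeight_nbhd (v : V) (b : Bool) (x y : G.neighborSet v) :
    pairWeight (nbhd G v) b x y = pairWeight G b x y := by
  simp [pairWeight_eq_ite, Subtype.ext_iff]

/-- A labelled sum over three vertices of the neighbourhood of `v` as a sum over all vertices. -/
theorem sum_nbhd_three (v : V) (b12 b13 b23 : Bool) :
    ∑ w, ∑ x, pairWeight (nbhd G v) b12 w x *
      ∑ y, pairWeight (nbhd G v) b13 w y * pairWeight (nbhd G v) b23 x y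
    = ∑ w, adjInd G v w * ∑ x, adjInd G v x * (pairWeight G b12 w x *
      ∑ y, adjInd G v y * (pairWeight G b13 w y * pairWeight G b23 x y)) := by
  simp only [pairWeight_nbhd]
  refine (sum_neighborSet G v fun w => ∑ x : G.neighborSet v, pairWeight G b12 w x *
    ∑ y : G.neighborSet v, pairWeight G b13 w y * pairWeight G b23 x y).trans ?_
  refine Finset.sum_congr rfl fun w _ => congrArg _ ?_
  refine (sum_neighborSet G v fun x => pairWeight G b12 w x *
    ∑ y : G.neighborSet v, pairWeight G b13 w y * pairWeight G b23 x y).trans ?_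
  exact Finset.sum_congr rfl fun x _ => congrArg _ (congrArg _
    (sum_neighborSet G v fun y => pairWeight G b13 w y * pairWeight G b23 x y))

/-- A labelled sum over four vertices of the neighbourhood of `v` as a sum over all vertices. -/
theorem sum_nbhd_four (v : V) (b12 b13 b23 b14 b24 b34 : Bool) :
    ∑ w, ∑ x, pairWeight (nbhd G v) b12 w x *
      ∑ y, pairWeight (nbhd G v) b13 w y * (pairWeight (nbhd G v) b23 x y *
      ∑ z, pairWeight (nbhd G v) b14 w z * (pairWeight (nbhd G v) b24 x z *
        pairWeight (nbhd G v) b34 y z))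
    = ∑ w, adjInd G v w * ∑ x, adjInd G v x * (pairWeight G b12 w x *
      ∑ y, adjInd G v y * (pairWeight G b13 w y * (pairWeight G b23 x y *
      ∑ z, adjInd G v z * (pairWeight G b14 w z * (pairWeight G b24 x z *
        pairWeight G b34 y z))))) := by
  simp only [pairWeight_nbhd]
  refine (sum_neighborSet G v fun w => ∑ x : G.neighborSet v, pairWeight G b12 w x *
    ∑ y : G.neighborSet v, pairWeight G b13 w y * (pairWeight G b23 x y *
    ∑ z : G.neighborSet v, pairWeight G b14 w z * (pairWeight G b24 x z *
      pairWeight G b34 y z))).trans ?_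
  refine Finset.sum_congr rfl fun w _ => congrArg _ ?_
  refine (sum_neighborSet G v fun x => pairWeight G b12 w x *
    ∑ y : G.neighborSet v, pairWeight G b13 w y * (pairWeight G b23 x y *
    ∑ z : G.neighborSet v, pairWeight G b14 w z * (pairWeight G b24 x z *
      pairWeight G b34 y z))).trans ?_
  refine Finset.sum_congr rfl fun x _ => congrArg _ (congrArg _ ?_)
  refine (sum_neighborSet G v fun y => pairWeight G b13 w y * (pairWeight G b23 x y *
    ∑ z : G.neighborSet v, pairWeight G b14 w z * (pairWeight G b24 x z *
      pairWeight G b34 y z))).trans ?_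
  exact Finset.sum_congr rfl fun y _ => congrArg _ (congrArg _ (congrArg _
    (sum_neighborSet G v fun z => pairWeight G b14 w z * (pairWeight G b24 x z *
      pairWeight G b34 y z))))

theorem triangle_nbhd (v : V) : 6 * (graphletCount 3 7 (nbhd G v) : ℚ)
    = ∑ y, adjInd G v y * ∑ z, adjInd G v z * (adjInd G y z *
      ∑ w, adjInd G v w * (adjInd G y w * adjInd G z w)) :=
  (graphletCount_three (nbhd G v) 7 6 ![0, 1, 2] true true true
    (by decide) (by decide +kernel) (by decide +kernel)).trans
    (sum_nbhd_three G v true true true)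

/-- Any of the four vertices can serve as the apex over a triangle. -/
theorem completeFour_eq_sum_nbhd :
    4 * (graphletCount 4 63 G : ℚ) = ∑ x, (graphletCount 3 7 (nbhd G x) : ℚ) := by
  have h := completeFour_count G
  simp only [← triangle_nbhd, ← Finset.mul_sum] at h
  linarith

/-- The apex `x` together with a triangle in its neighbourhood is a complete graph on four nodes,
and the leaf is any of the other `deg G x - 3` neighbours of `x`. -/
theorem kite_eq_sum_nbhd : (graphletCount 5 127 G : ℚ)
    = ∑ x, (graphletCount 3 7 (nbhd G x) : ℚ) * (deg G x - 3) := by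
  have h := graphletCount_five G 127 6 ![4, 1, 2, 3, 0] true true true true true true true
    false false false (by decide) (by decide +kernel) (by decide +kernel)
  have h2 : 6 * (graphletCount 5 127 G : ℚ)
      = ∑ x, 6 * (graphletCount 3 7 (nbhd G x) : ℚ) * (deg G x - 3) := by
    refine h.trans (Finset.sum_congr rfl fun x _ => ?_)
    rw [triangle_nbhd]
    simp only [Finset.sum_mul, mul_assoc]
    refine Finset.sum_congr rfl fun y _ => adjInd_mul_congr fun hxy => Finset.sum_congr rfl
      fun z _ => adjInd_mul_congr fun hxz => adjInd_mul_congr fun hyz => Finset.sum_congr rfl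
      fun w _ => adjInd_mul_congr fun hxw => adjInd_mul_congr fun hyw => adjInd_mul_congr
      fun hzw => ?_
    simp only [pairWeight]
    rw [sum_mul_neInd_three _ hyz.ne hyw.ne hzw.ne, adjInd_of_adj hxy, adjInd_of_adj hxz,
      adjInd_of_adj hxw, deg]
    ring
  simp only [mul_assoc, ← Finset.mul_sum] at h2
  linarith

/-- The crown is the cone over a 4-path with a unique apex, so pattern and base have equally many
automorphisms. In the cone lemmas below, the factor on the left is the quotient of the two
automorphism numbers, which is the number of possible apices. -/
theorem crown_eq_sum_nbhd :
    (graphletCount 5 239 G : ℚ) = ∑ x, (graphletCount 4 13 (nbhd G x) : ℚ) := by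
  have h := graphletCount_five G 239 2 ![4, 2, 3, 1, 0] true true true true true false true
    false true false (by decide) (by decide +kernel) (by decide +kernel)
  have h2 : 2 * (graphletCount 5 239 G : ℚ) = ∑ x, 2 * (graphletCount 4 13 (nbhd G x) : ℚ) :=
    h.trans (Finset.sum_congr rfl fun x _ => ((graphletCount_four (nbhd G x) 13 2 ![2, 3, 1, 0]
      true true false false true false (by decide) (by decide +kernel) (by decide +kernel)).trans
      (sum_nbhd_four G x true true false false true false)).symm)
  rw [← Finset.mul_sum] at h2
  linarith

theorem lamp_eq_sum_nbhd :
    2 * (graphletCount 5 255 G : ℚ) = ∑ x, (graphletCount 4 15 (nbhd G x) : ℚ) := by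
  have h := graphletCount_five G 255 4 ![3, 4, 1, 2, 0] true true true true true true true true
    false false (by decide) (by decide +kernel) (by decide +kernel)
  have h2 : 4 * (graphletCount 5 255 G : ℚ) = ∑ x, 2 * (graphletCount 4 15 (nbhd G x) : ℚ) :=
    h.trans (Finset.sum_congr rfl fun x _ => ((graphletCount_four (nbhd G x) 15 2 ![3, 1, 2, 0]
      true true true true false false (by decide) (by decide +kernel) (by decide +kernel)).trans
      (sum_nbhd_four G x true true true true false false)).symm)
  rw [← Finset.mul_sum] at h2
  linarith

theorem arrowhead_eq_sum_nbhd :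
    (graphletCount 5 507 G : ℚ) = ∑ x, (graphletCount 4 30 (nbhd G x) : ℚ) := by
  have h := graphletCount_five G 507 8 ![4, 0, 1, 2, 3] true true false true true true true true
    true false (by decide) (by decide +kernel) (by decide +kernel)
  have h2 : 8 * (graphletCount 5 507 G : ℚ) = ∑ x, 8 * (graphletCount 4 30 (nbhd G x) : ℚ) :=
    h.trans (Finset.sum_congr rfl fun x _ => ((graphletCount_four (nbhd G x) 30 8 ![0, 1, 2, 3]
      false true true true true false (by decide) (by decide +kernel) (by decide +kernel)).trans
      (sum_nbhd_four G x false true true true true false)).symm)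
  rw [← Finset.mul_sum] at h2
  linarith

theorem catsCradle_eq_sum_nbhd :
    3 * (graphletCount 5 511 G : ℚ) = ∑ x, (graphletCount 4 31 (nbhd G x) : ℚ) := by
  have h := graphletCount_five G 511 12 ![2, 3, 4, 0, 1] true true true true true true true true
    true false (by decide) (by decide +kernel) (by decide +kernel)
  have h2 : 12 * (graphletCount 5 511 G : ℚ) = ∑ x, 4 * (graphletCount 4 31 (nbhd G x) : ℚ) :=
    h.trans (Finset.sum_congr rfl fun x _ => ((graphletCount_four (nbhd G x) 31 4 ![2, 3, 0, 1]
      true true true true true false (by decide) (by decide +kernel) (by decide +kernel)).trans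
      (sum_nbhd_four G x true true true true true false)).symm)
  rw [← Finset.mul_sum] at h2
  linarith

theorem completeFive_eq_sum_nbhd :
    5 * (graphletCount 5 1023 G : ℚ) = ∑ x, (graphletCount 4 63 (nbhd G x) : ℚ) := by
  have h := graphletCount_five G 1023 120 ![0, 1, 2, 3, 4] true true true true true true true true
    true true (by decide) (by decide +kernel) (by decide +kernel)
  have h2 : 120 * (graphletCount 5 1023 G : ℚ) = ∑ x, 24 * (graphletCount 4 63 (nbhd G x) : ℚ) :=
    h.trans (Finset.sum_congr rfl fun x _ => ((graphletCount_four (nbhd G x) 63 24 ![0, 1, 2, 3]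
      true true true true true true (by decide) (by decide +kernel) (by decide +kernel)).trans
      (sum_nbhd_four G x true true true true true true)).symm)
  rw [← Finset.mul_sum] at h2
  linarith

end Cones

/-! ### Bounds that make the degree restrictions harmless -/

section Bounds

variable {V : Type*} [DecidableEq V] [Fintype V] (G : SimpleGraph V) [DecidableRel G.Adj]

theorem sum_filter_eq_sum {ι : Type*} [Fintype ι] {p : ι → Prop} [DecidablePred p] {f : ι → ℚ}
    (h : ∀ i, ¬ p i → f i = 0) : ∑ i with p i, f i = ∑ i, f i :=
  Finset.sum_filter_of_ne fun i _ hi => by_contra fun hp => hi (h i hp)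

variable {G} in
theorem adjInd_mul_eq_zero {x y : V} {p : ℚ} (h : G.Adj x y → p = 0) : adjInd G x y * p = 0 := by
  rw [adjInd_mul_congr h, mul_zero]

theorem neInd_mul_eq_zero {x y : V} {p : ℚ} (h : x ≠ y → p = 0) : neInd x y * p = 0 := by
  rw [neInd_mul_congr h, mul_zero]

theorem adjInd_nonneg (x y : V) : 0 ≤ adjInd G x y := by
  unfold adjInd; split_ifs <;> norm_num

theorem adjInd_le_one (x y : V) : adjInd G x y ≤ 1 := by
  unfold adjInd; split_ifs <;> norm_num

theorem codeg_le_deg (x y : V) : codeg G x y ≤ deg G x :=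
  Finset.sum_le_sum fun z _ => mul_le_of_le_one_right (adjInd_nonneg G x z) (adjInd_le_one G y z)

variable {G} in
-- `y` is a neighbour of `x` but not a neighbour of itself.
theorem codeg_le_deg_sub_one {x y : V} (h : G.Adj x y) : codeg G x y ≤ deg G x - 1 := by
  have h1 : codeg G x y ≤ ∑ z, adjInd G x z * neInd y z := by
    refine Finset.sum_le_sum fun z _ => mul_le_mul_of_nonneg_left ?_ (adjInd_nonneg G x z)
    by_cases hyz : y = z
    · simp [hyz]
    · rw [neInd_of_ne hyz]
      exact adjInd_le_one G y z
  rw [sum_mul_neInd, adjInd_of_adj h] at h1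
  exact h1

theorem triWalks_le (x : V) : triWalks G x ≤ deg G x * (deg G x - 1) := by
  rw [← sum_adjInd_mul_const, triWalks]
  refine Finset.sum_le_sum fun y _ => ?_
  by_cases h : G.Adj x y
  · exact mul_le_mul_of_nonneg_left (codeg_le_deg_sub_one h) (adjInd_nonneg G x y)
  · simp [adjInd, h]

theorem adjMatrix_sq_comm (x y : V) :
    ((G.adjMatrix ℕ) ^ 2) x y = ((G.adjMatrix ℕ) ^ 2) y x := by
  have h := codeg_comm G x y
  rw [← cast_pow_two, ← cast_pow_two] at h
  exact_mod_cast h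

theorem adjMatrix_sq_le_degree (x y : V) : ((G.adjMatrix ℕ) ^ 2) x y ≤ G.degree x := by
  have h := codeg_le_deg G x y
  rw [← cast_pow_two, ← degree_eq_deg] at h
  exact_mod_cast h

variable {G} in
theorem adjMatrix_sq_lt_degree {x y : V} (h : G.Adj x y) :
    ((G.adjMatrix ℕ) ^ 2) x y < G.degree x := by
  have h1 := codeg_le_deg_sub_one h
  rw [← cast_pow_two, ← degree_eq_deg] at h1
  have h2 : ((((G.adjMatrix ℕ) ^ 2) x y + 1 : ℕ) : ℚ) ≤ G.degree x := by
    push_cast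
    linarith
  exact_mod_cast h2

/-- Stated additively to avoid truncated subtraction; it forces the diagonal entry to vanish when
the degree is 0 or 1. -/
theorem adjMatrix_cube_add_degree_le (x : V) :
    ((G.adjMatrix ℕ) ^ 3) x x + G.degree x ≤ G.degree x * G.degree x := by
  have h := triWalks_le G x
  rw [← cast_pow_three_diag, ← degree_eq_deg] at h
  have h2 : ((((G.adjMatrix ℕ) ^ 3) x x + G.degree x : ℕ) : ℚ)
      ≤ ((G.degree x * G.degree x : ℕ) : ℚ) := by
    push_cast
    linarith
  exact_mod_cast h2

variable {G} in
theorem degree_pos_of_adj {x y : V} (h : G.Adj x y) : 0 < G.degree x :=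
  (G.degree_pos_iff_exists_adj x).2 ⟨y, h⟩

variable {G} in
theorem two_le_degree {x y z : V} (hy : G.Adj z x) (hz : G.Adj z y) (h : x ≠ y) :
    2 ≤ G.degree z := by
  rw [← Finset.card_pair h, ← SimpleGraph.card_neighborFinset_eq_degree]
  refine Finset.card_le_card fun w hw => ?_
  rw [SimpleGraph.mem_neighborFinset]
  rcases Finset.mem_insert.1 hw with rfl | hw
  · exact hy
  · rwa [Finset.mem_singleton.1 hw]

theorem codeg_eq_card (x y : V) :
    codeg G x y = (Finset.univ.filter fun z => G.Adj x z ∧ G.Adj y z).card := by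
  rw [codeg, ← Finset.sum_boole]
  refine Finset.sum_congr rfl fun z _ => ?_
  by_cases h1 : G.Adj x z <;> by_cases h2 : G.Adj y z <;> simp [adjInd, h1, h2]

variable {G} in
theorem one_le_adjMatrix_sq {x y z : V} (hx : G.Adj x z) (hy : G.Adj y z) :
    1 ≤ ((G.adjMatrix ℕ) ^ 2) x y := by
  have h := codeg_eq_card G x y
  rw [← cast_pow_two] at h
  rw [show ((G.adjMatrix ℕ) ^ 2) x y = _ from by exact_mod_cast h, Nat.one_le_iff_ne_zero,
    Finset.card_ne_zero]
  exact ⟨z, by simp [hx, hy]⟩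

variable {G} in
theorem two_le_adjMatrix_sq {x y z w : V} (hxz : G.Adj x z) (hyz : G.Adj y z) (hxw : G.Adj x w)
    (hyw : G.Adj y w) (h : z ≠ w) : 2 ≤ ((G.adjMatrix ℕ) ^ 2) x y := by
  have h1 := codeg_eq_card G x y
  rw [← cast_pow_two] at h1
  rw [show ((G.adjMatrix ℕ) ^ 2) x y = _ from by exact_mod_cast h1, ← Finset.card_pair h]
  refine Finset.card_le_card fun u hu => ?_
  rcases Finset.mem_insert.1 hu with rfl | hu
  · simp [hxz, hyz]
  · simp [Finset.mem_singleton.1 hu, hxw, hyw]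

theorem sum_commonNeighbors (x y : V) [Fintype (G.commonNeighbors x y)] (f : V → ℚ) :
    ∑ z ∈ (G.commonNeighbors x y).toFinset, f z = ∑ z, adjInd G x z * (adjInd G y z * f z) := by
  have h : (G.commonNeighbors x y).toFinset
      = Finset.univ.filter fun z => G.Adj x z ∧ G.Adj y z := by
    ext z
    simp [SimpleGraph.mem_commonNeighbors]
  rw [h, Finset.sum_filter]
  refine Finset.sum_congr rfl fun z _ => ?_
  by_cases h1 : G.Adj x z <;> by_cases h2 : G.Adj y z <;> simp [adjInd, h1, h2]

theorem deg_nbhd (x : V) (y : G.neighborSet x) : deg (nbhd G x) y = codeg G x y := by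
  rw [codeg, ← sum_neighborSet]
  rfl

/-- Closed walks of length three at `x` come in pairs, one for each edge of the neighbourhood. -/
theorem adjMatrix_cube_diag (x : V) :
    ((G.adjMatrix ℕ) ^ 3) x x = 2 * (nbhd G x).edgeFinset.card := by
  have h : (((G.adjMatrix ℕ) ^ 3) x x : ℚ) = ((2 * (nbhd G x).edgeFinset.card : ℕ) : ℚ) := by
    rw [← SimpleGraph.sum_degrees_eq_twice_card_edges, cast_pow_three_diag, triWalks,
      ← sum_neighborSet, Nat.cast_sum]
    exact Finset.sum_congr rfl fun y _ => by rw [degree_eq_deg, deg_nbhd]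
  exact_mod_cast h

theorem cast_choose_three (n : ℕ) : (n.choose 3 : ℚ) = n * (n - 1) * (n - 2) / 6 := by
  induction n with
  | zero => simp
  | succ n ih =>
    rw [Nat.choose_succ_succ, Nat.cast_add, ih, Nat.cast_choose_two]
    push_cast
    ring

theorem cast_choose_four (n : ℕ) : (n.choose 4 : ℚ) = n * (n - 1) * (n - 2) * (n - 3) / 24 := by
  induction n with
  | zero => simp
  | succ n ih =>
    rw [Nat.choose_succ_succ, Nat.cast_add, ih, cast_choose_three]
    push_cast
    ring

/-- Positivity of `r` is essential: off the edges the left side is `Nat.choose 0 r`, which must be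
0. -/
theorem cast_sq_mul_adjMatrix_choose (x y : V) {r : ℕ} (hr : 0 < r) :
    (((((G.adjMatrix ℕ) ^ 2) x y * G.adjMatrix ℕ x y).choose r : ℕ) : ℚ)
      = adjInd G x y * ((((G.adjMatrix ℕ) ^ 2) x y).choose r : ℕ) := by
  by_cases h : G.Adj x y
  · simp [adjInd, SimpleGraph.adjMatrix_apply, h]
  · simp [adjInd, SimpleGraph.adjMatrix_apply, h, Nat.choose_eq_zero_of_lt hr]

theorem graphletCount_nbhd_eq_zero (b a : ℕ) (x : V) (h : G.degree x < b) :
    graphletCount b a (nbhd G x) = 0 :=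
  graphletCount_eq_zero_of_card_lt _ a (by rwa [SimpleGraph.card_neighborSet_eq_degree])

theorem cast_trace_cube :
    ((((G.adjMatrix ℕ) ^ 3).trace : ℕ) : ℚ) = 6 * (graphletCount 3 7 G : ℚ) := by
  rw [triangle_count, Matrix.trace, Nat.cast_sum]
  exact Finset.sum_congr rfl fun x _ => cast_pow_three_diag G x

end Bounds

/-! ### The formulae with their degree restrictions -/

section Formulae

variable {V : Type*} [DecidableEq V] [Fintype V] (G : SimpleGraph V) [DecidableRel G.Adj]

theorem starFive_formula : (graphletCount 5 75 G : ℚ)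
    = 1 / 24 * ∑ i with 3 < G.degree i, (G.degree i : ℚ) * (G.degree i - 1) * (G.degree i - 2)
      * (G.degree i - 3) := by
  rw [sum_filter_eq_sum]
  · have h := starFive_count G
    simp only [← degree_eq_deg] at h
    linarith
  · intro i hi
    generalize G.degree i = n at hi
    have : n ≤ 3 := by omega
    interval_cases n <;> norm_num

theorem starFive_formula_choose : (graphletCount 5 75 G : ℚ)
    = ∑ i with 3 < G.degree i, ((G.degree i).choose 4 : ℚ) := by
  rw [starFive_formula, Finset.mul_sum]
  exact Finset.sum_congr rfl fun i _ => by rw [cast_choose_four]; ring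

theorem arrow_formula : (graphletCount 5 77 G : ℚ)
    = 1 / 2 * (∑ i with 2 < G.degree i, ∑ j with G.Adj i j,
      ((G.degree i : ℚ) - 1) * (G.degree i - 2) * (G.degree j - 1))
      - 2 * (graphletCount 4 15 G : ℚ) := by
  simp only [sum_adj]
  rw [sum_filter_eq_sum]
  · have h := arrow_count G
    simp only [← degree_eq_deg] at h
    linarith
  · intro i hi
    refine Finset.sum_eq_zero fun j _ => adjInd_mul_eq_zero fun hij => ?_
    have h0 := degree_pos_of_adj hij
    generalize G.degree i = n at hi h0
    have : n ≤ 2 := by omega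
    interval_cases n <;> norm_num

theorem arrow_formula_choose : (graphletCount 5 77 G : ℚ)
    = (∑ i with 2 < G.degree i, ∑ j with G.Adj i j,
      ((G.degree i - 1).choose 2 : ℚ) * ((G.degree j : ℚ) - 1))
      - 2 * (graphletCount 4 15 G : ℚ) := by
  rw [arrow_formula, Finset.mul_sum]
  congr 1
  refine Finset.sum_congr rfl fun i hi => ?_
  have h : 1 ≤ G.degree i := by have := (Finset.mem_filter.1 hi).2; omega
  rw [Finset.mul_sum]
  refine Finset.sum_congr rfl fun j _ => ?_
  rw [Nat.cast_choose_two, Nat.cast_sub h]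
  push_cast
  ring

theorem cricket_formula : (graphletCount 5 79 G : ℚ)
    = 1 / 4 * ∑ i with 3 < G.degree i, (((G.adjMatrix ℕ) ^ 3) i i : ℚ) * (G.degree i - 2)
      * (G.degree i - 3) := by
  rw [sum_filter_eq_sum]
  · have h := cricket_count G
    simp only [← degree_eq_deg, ← cast_pow_three_diag, ← mul_assoc] at h
    linarith
  · intro i hi
    have h := adjMatrix_cube_add_degree_le G i
    generalize G.degree i = n at hi h
    generalize ((G.adjMatrix ℕ) ^ 3) i i = t at h
    have : n ≤ 3 := by omega
    -- In degrees 0 and 1 there are no closed 3-walks; in degrees 2 and 3 a linear factor vanishes.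
    interval_cases n
    · simp [show t = 0 by omega]
    · simp [show t = 0 by omega]
    · norm_num
    · norm_num

theorem cricket_formula_choose : (graphletCount 5 79 G : ℚ)
    = 1 / 2 * ∑ i with 3 < G.degree i, (((G.adjMatrix ℕ) ^ 3) i i : ℚ)
      * ((G.degree i - 2).choose 2 : ℚ) := by
  rw [cricket_formula, Finset.mul_sum, Finset.mul_sum]
  refine Finset.sum_congr rfl fun i hi => ?_
  have h : 2 ≤ G.degree i := by have := (Finset.mem_filter.1 hi).2; omega
  rw [Nat.cast_choose_two, Nat.cast_sub h]
  push_cast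
  ring

theorem pathFive_formula : (graphletCount 5 86 G : ℚ)
    = 1 / 2 * (∑ i, ∑ j with i ≠ j, (((G.adjMatrix ℕ) ^ 4) i j : ℚ))
      - 2 * (graphletCount 3 3 G : ℚ) - 9 * (graphletCount 3 7 G : ℚ)
      - 3 * (graphletCount 4 11 G : ℚ) - 2 * (graphletCount 4 13 G : ℚ)
      - 2 * (graphletCount 4 15 G : ℚ) := by
  simp only [sum_ne, cast_pow_four]
  linarith [pathFive_count G]

theorem bull_formula : (graphletCount 5 87 G : ℚ) = edgeSum G (fun i j =>
      if 2 < G.degree i ∧ 2 < G.degree j then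
        (((G.adjMatrix ℕ) ^ 2) i j : ℚ) * (G.degree i - 2) * (G.degree j - 2) else 0)
      - 2 * (graphletCount 4 31 G : ℚ) := by
  have h := bull_count G
  simp only [← degree_eq_deg, ← cast_pow_two] at h
  rw [edgeSum_eq_sum, Finset.sum_congr rfl fun i _ => Finset.sum_congr rfl fun j _ =>
    adjInd_mul_congr (q := (((G.adjMatrix ℕ) ^ 2) i j : ℚ)
      * (((G.degree i : ℚ) - 2) * ((G.degree j : ℚ) - 2))) fun hij => ?_]
  · linarith
  · split_ifs with hk
    · ring
    · have key : ∀ c a : ℕ, c < a → ¬ 2 < a → (c : ℚ) * (a - 2) = 0 := by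
        intro c a hc ha
        have : a ≤ 2 := by omega
        interval_cases a
        · omega
        · simp [show c = 0 by omega]
        · norm_num
      rcases not_and_or.1 hk with hk | hk
      · rw [← mul_assoc, key _ _ (adjMatrix_sq_lt_degree hij) hk, zero_mul]
      · rw [mul_left_comm, adjMatrix_sq_comm, key _ _ (adjMatrix_sq_lt_degree hij.symm) hk,
          mul_zero]

theorem banner_formula : (graphletCount 5 94 G : ℚ)
    = 1 / 2 * (∑ i with 2 < G.degree i, ∑ j with i ≠ j, (((G.adjMatrix ℕ) ^ 2) i j : ℚ)
      * (((G.adjMatrix ℕ) ^ 2) i j - 1) * (G.degree i - 2))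
      - 2 * (graphletCount 4 31 G : ℚ) := by
  simp only [sum_ne]
  rw [sum_filter_eq_sum]
  · have h := banner_count G
    simp only [← degree_eq_deg, ← cast_pow_two] at h
    linarith
  · intro i hi
    refine Finset.sum_eq_zero fun j _ => neInd_mul_eq_zero fun hij => ?_
    have h := adjMatrix_sq_le_degree G i j
    generalize G.degree i = n at hi h
    generalize ((G.adjMatrix ℕ) ^ 2) i j = c at h
    have : n ≤ 2 := by omega
    interval_cases n <;> interval_cases c <;> norm_num

theorem banner_formula_choose : (graphletCount 5 94 G : ℚ)
    = (∑ i with 2 < G.degree i, ∑ j with i ≠ j, ((((G.adjMatrix ℕ) ^ 2) i j).choose 2 : ℚ)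
      * ((G.degree i : ℚ) - 2)) - 2 * (graphletCount 4 31 G : ℚ) := by
  rw [banner_formula]
  simp only [Finset.mul_sum (_ : Finset V), Nat.cast_choose_two]
  congr 1
  exact Finset.sum_congr rfl fun i _ => Finset.sum_congr rfl fun j _ => by ring

theorem stingray_formula : (graphletCount 5 95 G : ℚ)
    = 1 / 2 * ∑ i with 3 < G.degree i, ∑ j with G.Adj i j, (((G.adjMatrix ℕ) ^ 2) i j : ℚ)
      * (((G.adjMatrix ℕ) ^ 2) i j - 1) * (G.degree i - 3) := by
  simp only [sum_adj]
  rw [sum_filter_eq_sum]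
  · have h := stingray_count G
    simp only [← degree_eq_deg, ← cast_pow_two] at h
    linarith
  · intro i hi
    refine Finset.sum_eq_zero fun j _ => adjInd_mul_eq_zero fun hij => ?_
    have h := adjMatrix_sq_lt_degree hij
    generalize G.degree i = n at hi h
    generalize ((G.adjMatrix ℕ) ^ 2) i j = c at h
    have : n ≤ 3 := by omega
    interval_cases n <;> interval_cases c <;> norm_num

theorem sum_ne_eq_sum_adj (i : V) (f : V → ℚ) :
    ∑ j with i ≠ j, adjInd G i j * f j = ∑ j with G.Adj i j, f j := by
  rw [sum_ne, sum_adj]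
  refine Finset.sum_congr rfl fun j _ => ?_
  rw [← mul_assoc, mul_comm (neInd i j), adjInd_mul_neInd]

theorem stingray_formula_choose : (graphletCount 5 95 G : ℚ)
    = ∑ i with 3 < G.degree i, ∑ j with i ≠ j,
      ((((G.adjMatrix ℕ) ^ 2) i j * G.adjMatrix ℕ i j).choose 2 : ℚ)
      * ((G.degree i : ℚ) - 3) := by
  simp only [cast_sq_mul_adjMatrix_choose G _ _ two_pos, mul_assoc, sum_ne_eq_sum_adj,
    Nat.cast_choose_two]
  rw [stingray_formula]
  simp only [Finset.mul_sum (_ : Finset V)]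
  exact Finset.sum_congr rfl fun i _ => Finset.sum_congr rfl fun j _ => by ring

theorem lollipop_formula : (graphletCount 5 117 G : ℚ)
    = 1 / 2 * (∑ i, ∑ j with G.Adj i j, (((G.adjMatrix ℕ) ^ 3) i i : ℚ) * (G.degree j - 1))
      - 6 * (graphletCount 3 7 G : ℚ) - 2 * (graphletCount 4 15 G : ℚ)
      - 4 * (graphletCount 4 31 G : ℚ) := by
  have h := lollipop_count G
  simp only [sum_adj, cast_pow_three_diag, ← Finset.mul_sum, degree_eq_deg]
  linarith

theorem spinningTop_formula : (graphletCount 5 119 G : ℚ) = edgeSum G (fun i j =>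
      if 2 < G.degree i ∧ 2 < G.degree j then
        ((((G.adjMatrix ℕ) ^ 2) i j : ℚ) - 1) *
          ∑ r ∈ (G.commonNeighbors i j).toFinset with 1 < G.degree r, ((G.degree r : ℚ) - 2)
      else 0) - 12 * (graphletCount 4 63 G : ℚ) := by
  have h := spinningTop_count G
  simp only [← degree_eq_deg, ← cast_pow_two] at h
  rw [edgeSum_eq_sum, Finset.sum_congr rfl fun i _ => Finset.sum_congr rfl fun j _ =>
    adjInd_mul_congr (q := ∑ r, adjInd G i r * (adjInd G j r *
      (((((G.adjMatrix ℕ) ^ 2) i j : ℚ) - 1) * ((G.degree r : ℚ) - 2)))) fun hij => ?_]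
  · linarith
  · split_ifs with hk
    · rw [Finset.sum_filter, sum_commonNeighbors, Finset.mul_sum]
      refine Finset.sum_congr rfl fun r _ => ?_
      rw [mul_left_comm, mul_left_comm _ (adjInd G j r)]
      refine adjInd_mul_congr fun hir => adjInd_mul_congr fun hjr => ?_
      -- A common neighbour of the distinct vertices `i`, `j` has degree at least 2, so the inner
      -- restriction is vacuous.
      rw [if_pos (show 1 < G.degree r from two_le_degree hir.symm hjr.symm hij.ne)]
    · symm
      refine Finset.sum_eq_zero fun r _ => adjInd_mul_eq_zero fun hir => adjInd_mul_eq_zero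
        fun hjr => ?_
      have h1 := one_le_adjMatrix_sq hir hjr
      have h2 := adjMatrix_sq_lt_degree hij
      have h3 := adjMatrix_sq_lt_degree hij.symm
      rw [adjMatrix_sq_comm] at h3
      -- An end of degree at most 2 leaves room for only one common neighbour, which kills the
      -- factor with `- 1`.
      have h4 : ((G.adjMatrix ℕ) ^ 2) i j = 1 := by omega
      rw [h4]
      simp

theorem kite_formula : (graphletCount 5 127 G : ℚ)
    = ∑ i with 3 < G.degree i, (graphletCount 3 7 (nbhd G i) : ℚ) * ((G.degree i : ℚ) - 3) := by
  rw [sum_filter_eq_sum]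
  · rw [kite_eq_sum_nbhd]
    simp only [degree_eq_deg]
  · intro i hi
    rcases eq_or_lt_of_le (not_lt.1 hi) with h | h
    · simp [h]
    · simp [graphletCount_nbhd_eq_zero G 3 7 i h]

theorem kite_formula_trace : (graphletCount 5 127 G : ℚ)
    = 1 / 6 * ∑ i with 3 < G.degree i,
      ((((nbhd G i).adjMatrix ℕ) ^ 3).trace : ℚ) * ((G.degree i : ℚ) - 3) := by
  rw [kite_formula, Finset.mul_sum]
  exact Finset.sum_congr rfl fun i _ => by rw [cast_trace_cube]; ring

theorem sum_filter_ne_and_eq {p : V → Prop} [DecidablePred p] (i : V) (f : V → ℚ)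
    (h : ∀ j, ¬ p j → f j = 0) : ∑ j with i ≠ j ∧ p j, f j = ∑ j with i ≠ j, f j := by
  rw [← Finset.filter_filter]
  exact Finset.sum_filter_of_ne fun j _ hj => by_contra fun hp => hj (h j hp)

theorem ufo_formula : (graphletCount 5 222 G : ℚ)
    = 1 / 12 * ∑ i with 2 < G.degree i, ∑ j with i ≠ j ∧ 2 < G.degree j,
      (((G.adjMatrix ℕ) ^ 2) i j : ℚ) * (((G.adjMatrix ℕ) ^ 2) i j - 1)
      * (((G.adjMatrix ℕ) ^ 2) i j - 2) := by
  have key : ∀ i j, ¬ (2 < G.degree i) → (((G.adjMatrix ℕ) ^ 2) i j : ℚ)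
      * (((G.adjMatrix ℕ) ^ 2) i j - 1) * (((G.adjMatrix ℕ) ^ 2) i j - 2) = 0 := by
    intro i j hi
    have h := adjMatrix_sq_le_degree G i j
    generalize ((G.adjMatrix ℕ) ^ 2) i j = c at h
    have : c ≤ 2 := by omega
    interval_cases c <;> norm_num
  rw [sum_filter_eq_sum fun i hi => Finset.sum_eq_zero fun j _ => key i j hi,
    Finset.sum_congr rfl fun i _ => sum_filter_ne_and_eq i _ fun j hj => ?_]
  · have h := ufo_count G
    simp only [sum_ne, cast_pow_two]
    linarith
  · rw [adjMatrix_sq_comm]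
    exact key j i hj

theorem ufo_formula_choose : (graphletCount 5 222 G : ℚ)
    = 1 / 2 * ∑ i with 2 < G.degree i, ∑ j with i ≠ j ∧ 2 < G.degree j,
      ((((G.adjMatrix ℕ) ^ 2) i j).choose 3 : ℚ) := by
  rw [ufo_formula]
  simp only [Finset.mul_sum (_ : Finset V), cast_choose_three]
  exact Finset.sum_congr rfl fun i _ => Finset.sum_congr rfl fun j _ => by ring

theorem adj_sq_falling_eq_zero {i j : V} (hij : G.Adj i j) (hk : ¬ 3 < G.degree i) :
    (((G.adjMatrix ℕ) ^ 2) i j : ℚ) * (((G.adjMatrix ℕ) ^ 2) i j - 1)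
      * (((G.adjMatrix ℕ) ^ 2) i j - 2) = 0 := by
  have h := adjMatrix_sq_lt_degree hij
  generalize ((G.adjMatrix ℕ) ^ 2) i j = c at h
  have : c ≤ 2 := by omega
  interval_cases c <;> norm_num

theorem chevron_formula : (graphletCount 5 223 G : ℚ) = 1 / 6 * edgeSum G (fun i j =>
      if 3 < G.degree i ∧ 3 < G.degree j then
        (((G.adjMatrix ℕ) ^ 2) i j : ℚ) * (((G.adjMatrix ℕ) ^ 2) i j - 1)
          * (((G.adjMatrix ℕ) ^ 2) i j - 2)
      else 0) := by
  have h := chevron_count G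
  simp only [← cast_pow_two] at h
  rw [edgeSum_eq_sum, Finset.sum_congr rfl fun i _ => Finset.sum_congr rfl fun j _ =>
    adjInd_mul_congr (q := (((G.adjMatrix ℕ) ^ 2) i j : ℚ) * (((G.adjMatrix ℕ) ^ 2) i j - 1)
          * (((G.adjMatrix ℕ) ^ 2) i j - 2)) fun hij => ?_]
  · linarith
  · split_ifs with hk
    · rfl
    · rcases not_and_or.1 hk with hk | hk
      · rw [adj_sq_falling_eq_zero G hij hk]
      · rw [adjMatrix_sq_comm, adj_sq_falling_eq_zero G hij.symm hk]

theorem chevron_formula_choose : (graphletCount 5 223 G : ℚ)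
    = 1 / 2 * ∑ i with 3 < G.degree i, ∑ j with i ≠ j ∧ 3 < G.degree j,
      ((((G.adjMatrix ℕ) ^ 2) i j * G.adjMatrix ℕ i j).choose 3 : ℚ) := by
  simp only [cast_sq_mul_adjMatrix_choose G _ _ three_pos, cast_choose_three]
  rw [sum_filter_eq_sum fun i hi => Finset.sum_eq_zero fun j _ => adjInd_mul_eq_zero fun hij => by
      rw [adj_sq_falling_eq_zero G hij hi, zero_div],
    Finset.sum_congr rfl fun i _ => sum_filter_ne_and_eq i _ fun j hj => adjInd_mul_eq_zero
      fun hij => by rw [adjMatrix_sq_comm, adj_sq_falling_eq_zero G hij.symm hj, zero_div]]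
  have h := chevron_count G
  simp only [sum_ne_eq_sum_adj, sum_adj, cast_pow_two]
  simp only [← mul_div_assoc, ← Finset.sum_div]
  linarith

theorem hourglass_formula : (graphletCount 5 235 G : ℚ)
    = 1 / 8 * (∑ i with 2 < G.degree i, (((G.adjMatrix ℕ) ^ 3) i i : ℚ)
      * (((G.adjMatrix ℕ) ^ 3) i i - 2)) - 2 * (graphletCount 4 31 G : ℚ) := by
  rw [sum_filter_eq_sum]
  · have h := hourglass_count G
    simp only [← cast_pow_three_diag] at h
    linarith
  · intro i hi
    have h := adjMatrix_cube_add_degree_le G i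
    rw [adjMatrix_cube_diag] at h ⊢
    generalize G.degree i = n at hi h
    generalize (nbhd G i).edgeFinset.card = t at h
    have hn : n ≤ 2 := by omega
    -- At most one edge lies in the neighbourhood, and `2 * t * (2 * t - 2)` vanishes for `t` equal
    -- to 0 or 1.
    have ht : t ≤ 1 := by interval_cases n <;> omega
    interval_cases t <;> norm_num

/-- Half the diagonal entry is the number of edges in the neighbourhood, so the rational binomial is
an ordinary one. -/
theorem hourglass_formula_choose : (graphletCount 5 235 G : ℚ)
    = (∑ i with 2 < G.degree i, Ring.choose (1 / 2 * (((G.adjMatrix ℕ) ^ 3) i i : ℚ)) 2)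
      - 2 * (graphletCount 4 31 G : ℚ) := by
  rw [hourglass_formula, Finset.mul_sum]
  congr 1
  refine Finset.sum_congr rfl fun i _ => ?_
  rw [adjMatrix_cube_diag]
  push_cast
  rw [show (1 / 2 : ℚ) * (2 * ((nbhd G i).edgeFinset.card : ℚ)) = (nbhd G i).edgeFinset.card by
    ring, Ring.choose_natCast, Nat.cast_choose_two]
  ring

theorem cycleFive_formula : (graphletCount 5 236 G : ℚ)
    = 1 / 10 * ((((G.adjMatrix ℕ) ^ 5).trace : ℚ) - 30 * (graphletCount 3 7 G : ℚ)
      - 10 * (graphletCount 4 15 G : ℚ)) := by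
  have h := cycleFive_count G
  rw [Matrix.trace, Nat.cast_sum]
  simp only [Matrix.diag_apply, cast_pow_five]
  linarith

theorem house_formula : (graphletCount 5 237 G : ℚ)
    = edgeSum G (fun i j => (((G.adjMatrix ℕ) ^ 3) i j : ℚ) * (((G.adjMatrix ℕ) ^ 2) i j : ℚ))
      - 9 * (graphletCount 3 7 G : ℚ) - 2 * (graphletCount 4 15 G : ℚ)
      - 4 * (graphletCount 4 31 G : ℚ) := by
  have h := house_count G
  simp only [edgeSum_eq_sum, cast_pow_two, cast_pow_three]
  linarith

theorem pathFour_formula : (graphletCount 4 13 G : ℚ)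
    = edgeSum G (fun j r => ((G.degree j : ℚ) - 1) * ((G.degree r : ℚ) - 1))
      - 3 * (graphletCount 3 7 G : ℚ) := by
  have h := pathFour_count G
  rw [← triangle_count] at h
  simp only [edgeSum_eq_sum, degree_eq_deg]
  linarith

theorem crown_formula : (graphletCount 5 239 G : ℚ)
    = ∑ i with 3 < G.degree i, (graphletCount 4 13 (nbhd G i) : ℚ) := by
  rw [crown_eq_sum_nbhd, sum_filter_eq_sum fun i hi => by
    rw [graphletCount_nbhd_eq_zero G 4 13 i (by omega), Nat.cast_zero]]

theorem envelope_formula : (graphletCount 5 254 G : ℚ) = edgeSum G (fun i j =>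
      if 2 < G.degree i ∧ 2 < G.degree j then
        1 / 2 * ∑ r ∈ (G.commonNeighbors i j).toFinset with 2 < G.degree r,
          ∑ q ∈ (G.commonNeighbors i j).toFinset with r ≠ q ∧ 2 < G.degree q,
            ((((G.adjMatrix ℕ) ^ 2) r q : ℚ) - 2)
      else 0) := by
  have h := envelope_count G
  simp only [← cast_pow_two] at h
  rw [edgeSum_eq_sum, Finset.sum_congr rfl fun i _ => Finset.sum_congr rfl fun j _ =>
    adjInd_mul_congr (q := 1 / 2 * ∑ r, adjInd G i r * (adjInd G j r * ∑ q, adjInd G i q *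
      (adjInd G j q * (neInd r q * ((((G.adjMatrix ℕ) ^ 2) r q : ℚ) - 2))))) fun hij => ?_]
  · simp only [mul_left_comm _ (1 / 2 : ℚ), ← Finset.mul_sum (_ : Finset V) _ (1 / 2 : ℚ)]
    linarith
  -- `r` and `q` have `i` and `j` as common neighbours; if `r` has degree at most 2 there are no
  -- others.
  · have key : ∀ r q, G.Adj i r → G.Adj j r → G.Adj i q → G.Adj j q → ¬ 2 < G.degree r →
        ((((G.adjMatrix ℕ) ^ 2) r q : ℚ) - 2) = 0 := by
      intro r q hir hjr hiq hjq hr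
      have h1 := two_le_adjMatrix_sq hir.symm hiq.symm hjr.symm hjq.symm hij.ne
      have h2 := adjMatrix_sq_le_degree G r q
      rw [show ((G.adjMatrix ℕ) ^ 2) r q = 2 by omega]
      norm_num
    split_ifs with hk
    · congr 1
      rw [Finset.sum_filter, sum_commonNeighbors]
      refine Finset.sum_congr rfl fun r _ => adjInd_mul_congr fun hir => adjInd_mul_congr
        fun hjr => ?_
      by_cases hr : 2 < G.degree r
      · rw [if_pos hr, Finset.sum_filter, sum_commonNeighbors]
        refine Finset.sum_congr rfl fun q _ => adjInd_mul_congr fun hiq => adjInd_mul_congr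
          fun hjq => ?_
        by_cases hrq : r = q
        · simp [hrq]
        · rw [neInd_of_ne hrq, one_mul]
          split_ifs with hq
          · rfl
          · rw [adjMatrix_sq_comm, key q r hiq hjq hir hjr fun h => hq ⟨hrq, h⟩]
      · rw [if_neg hr]
        exact (Finset.sum_eq_zero fun q _ => adjInd_mul_eq_zero fun hiq => adjInd_mul_eq_zero
          fun hjq => neInd_mul_eq_zero fun _ => key r q hir hjr hiq hjq hr).symm
    · symm
      rw [mul_eq_zero]
      right
      refine Finset.sum_eq_zero fun r _ => adjInd_mul_eq_zero fun hir => adjInd_mul_eq_zero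
        fun hjr => Finset.sum_eq_zero fun q _ => adjInd_mul_eq_zero fun hiq => adjInd_mul_eq_zero
        fun hjq => neInd_mul_eq_zero fun hrq => absurd ?_ hk
      -- Two common neighbours and the edge `i j` itself force both ends to have degree at least 3.
      have h1 := two_le_adjMatrix_sq hir hjr hiq hjq hrq
      have h2 := adjMatrix_sq_lt_degree hij
      have h3 := adjMatrix_sq_lt_degree hij.symm
      rw [adjMatrix_sq_comm] at h3
      omega

theorem paw_formula : (graphletCount 4 15 G : ℚ)
    = 1 / 2 * ∑ r with 2 < G.degree r, (((G.adjMatrix ℕ) ^ 3) r r : ℚ)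
      * ((G.degree r : ℚ) - 2) := by
  rw [sum_filter_eq_sum]
  · have h := paw_count G
    simp only [← degree_eq_deg, ← cast_pow_three_diag] at h
    linarith
  · intro i hi
    have h := adjMatrix_cube_add_degree_le G i
    generalize G.degree i = n at hi h
    generalize ((G.adjMatrix ℕ) ^ 3) i i = t at h
    have : n ≤ 2 := by omega
    interval_cases n
    · simp [show t = 0 by omega]
    · simp [show t = 0 by omega]
    · norm_num

theorem lamp_formula : (graphletCount 5 255 G : ℚ)
    = 1 / 2 * ∑ i with 3 < G.degree i, (graphletCount 4 15 (nbhd G i) : ℚ) := by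
  have h := lamp_eq_sum_nbhd G
  rw [sum_filter_eq_sum fun i hi => by
    rw [graphletCount_nbhd_eq_zero G 4 15 i (by omega), Nat.cast_zero]]
  linarith

/-- Closed 4-walks that are not 4-cycles are supported on one edge (2 walks each) or on a path with
two edges (4 walks each). -/
theorem cycleFour_formula : (graphletCount 4 30 G : ℚ)
    = 1 / 8 * ((((G.adjMatrix ℕ) ^ 4).trace : ℚ) - 2 * (G.edgeFinset.card : ℚ)
      - 4 * (graphletCount 3 3 G : ℚ)) := by
  have h1 := cycleFour_count G
  have h2 := pathThree_count G
  have h3 : 2 * (G.edgeFinset.card : ℚ) = ∑ x, deg G x := by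
    have := G.sum_degrees_eq_twice_card_edges
    have h4 : ((∑ x, G.degree x : ℕ) : ℚ) = ((2 * G.edgeFinset.card : ℕ) : ℚ) := by rw [this]
    push_cast at h4
    simp only [degree_eq_deg] at h4
    exact h4.symm
  have h4 : ∑ x, ∑ y, codeg G x y = ∑ x, deg G x * deg G x := by
    simp only [sum_codeg_right]
    rw [sum_adjInd_swap]
    simp only [sum_adjInd_mul_const]
  rw [Matrix.trace, Nat.cast_sum]
  simp only [Matrix.diag_apply, cast_pow_four]
  rw [sum_neInd_mul] at h1
  simp only [mul_sub, mul_one, Finset.sum_sub_distrib, codeg_self] at h1 h2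
  simp only [codeg_comm G _ _] at h1 ⊢
  linarith

theorem arrowhead_formula : (graphletCount 5 507 G : ℚ)
    = ∑ i with 3 < G.degree i, (graphletCount 4 30 (nbhd G i) : ℚ) := by
  rw [arrowhead_eq_sum_nbhd, sum_filter_eq_sum fun i hi => by
    rw [graphletCount_nbhd_eq_zero G 4 30 i (by omega), Nat.cast_zero]]

theorem diamond_formula : (graphletCount 4 31 G : ℚ)
    = 1 / 2 * ∑ r with 2 < G.degree r, ∑ s with r ≠ s ∧ 2 < G.degree s,
      ((((G.adjMatrix ℕ) ^ 2) r s * G.adjMatrix ℕ r s).choose 2 : ℚ) := by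
  have key : ∀ i j, G.Adj i j → ¬ 2 < G.degree i →
      (((G.adjMatrix ℕ) ^ 2) i j : ℚ) * (((G.adjMatrix ℕ) ^ 2) i j - 1) / 2 = 0 := by
    intro i j hij hk
    have h := adjMatrix_sq_lt_degree hij
    generalize ((G.adjMatrix ℕ) ^ 2) i j = c at h
    have : c ≤ 1 := by omega
    interval_cases c <;> norm_num
  simp only [cast_sq_mul_adjMatrix_choose G _ _ two_pos, Nat.cast_choose_two]
  rw [sum_filter_eq_sum fun i hi => Finset.sum_eq_zero fun j _ => adjInd_mul_eq_zero fun hij =>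
      key i j hij hi,
    Finset.sum_congr rfl fun i _ => sum_filter_ne_and_eq i _ fun j hj => adjInd_mul_eq_zero
      fun hij => by rw [adjMatrix_sq_comm, key j i hij.symm hj]]
  have h := diamond_count G
  simp only [sum_ne_eq_sum_adj, sum_adj, cast_pow_two]
  simp only [← mul_div_assoc, ← Finset.sum_div]
  linarith

theorem catsCradle_formula : (graphletCount 5 511 G : ℚ)
    = 1 / 3 * ∑ i with 3 < G.degree i, (graphletCount 4 31 (nbhd G i) : ℚ) := by
  have h := catsCradle_eq_sum_nbhd G
  rw [sum_filter_eq_sum fun i hi => by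
    rw [graphletCount_nbhd_eq_zero G 4 31 i (by omega), Nat.cast_zero]]
  linarith

theorem completeFour_formula : (graphletCount 4 63 G : ℚ)
    = 1 / 24 * ∑ j with 2 < G.degree j, ((((nbhd G j).adjMatrix ℕ) ^ 3).trace : ℚ) := by
  have h := completeFour_eq_sum_nbhd G
  simp only [cast_trace_cube]
  rw [sum_filter_eq_sum fun i hi => by
    rw [graphletCount_nbhd_eq_zero G 3 7 i (by omega), Nat.cast_zero, mul_zero],
    ← Finset.mul_sum]
  linarith

theorem completeFive_formula : (graphletCount 5 1023 G : ℚ)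
    = 1 / 5 * ∑ i with 3 < G.degree i, (graphletCount 4 63 (nbhd G i) : ℚ) := by
  have h := completeFive_eq_sum_nbhd G
  rw [sum_filter_eq_sum fun i hi => by
    rw [graphletCount_nbhd_eq_zero G 4 63 i (by omega), Nat.cast_zero]]
  linarith

end Formulae

/-! ### Assembly of the formulae -/

theorem theorem1 {V : Type*} [Fintype V] [DecidableEq V] (G : SimpleGraph V)
    [DecidableRel G.Adj] :
    -- `g` is the adjacency matrix, `k i` the degree of `i`, `M b a` the non-induced count in `G`
    let g : Matrix V V ℕ := G.adjMatrix ℕ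
    let k : V → ℕ := fun i => G.degree i
    let M : ℕ → ℕ → ℚ := fun b a => (graphletCount b a G : ℚ)
    -- 5-star
    (M 5 75 = ∑ i with 3 < k i, ((k i).choose 4 : ℚ) ∧
      M 5 75 = 1 / 24 * ∑ i with 3 < k i, (k i : ℚ) * (k i - 1) * (k i - 2) * (k i - 3)) ∧
    -- 5-arrow
    (M 5 77 = (∑ i with 2 < k i, ∑ j with G.Adj i j, ((k i - 1).choose 2 : ℚ) * ((k j : ℚ) - 1))
        - 2 * M 4 15 ∧
      M 5 77 = 1 / 2 * (∑ i with 2 < k i, ∑ j with G.Adj i j,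
          ((k i : ℚ) - 1) * (k i - 2) * (k j - 1)) - 2 * M 4 15) ∧
    -- cricket
    (M 5 79 = 1 / 2 * ∑ i with 3 < k i, ((g ^ 3) i i : ℚ) * ((k i - 2).choose 2 : ℚ) ∧
      M 5 79 = 1 / 4 * ∑ i with 3 < k i, ((g ^ 3) i i : ℚ) * (k i - 2) * (k i - 3)) ∧
    -- 5-path
    (M 5 86 = 1 / 2 * (∑ i, ∑ j with i ≠ j, ((g ^ 4) i j : ℚ))
        - 2 * M 3 3 - 9 * M 3 7 - 3 * M 4 11 - 2 * M 4 13 - 2 * M 4 15) ∧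
    -- bull
    (M 5 87 = edgeSum G (fun i j =>
          if 2 < k i ∧ 2 < k j then ((g ^ 2) i j : ℚ) * (k i - 2) * (k j - 2) else 0)
        - 2 * M 4 31) ∧
    -- banner
    (M 5 94 = (∑ i with 2 < k i, ∑ j with i ≠ j, (((g ^ 2) i j).choose 2 : ℚ) * ((k i : ℚ) - 2))
        - 2 * M 4 31 ∧
      M 5 94 = 1 / 2 * (∑ i with 2 < k i, ∑ j with i ≠ j,
          ((g ^ 2) i j : ℚ) * ((g ^ 2) i j - 1) * (k i - 2)) - 2 * M 4 31) ∧
    -- stingray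
    (M 5 95 = ∑ i with 3 < k i, ∑ j with i ≠ j,
          (((g ^ 2) i j * g i j).choose 2 : ℚ) * ((k i : ℚ) - 3) ∧
      M 5 95 = 1 / 2 * ∑ i with 3 < k i, ∑ j with G.Adj i j,
          ((g ^ 2) i j : ℚ) * ((g ^ 2) i j - 1) * (k i - 3)) ∧
    -- lollipop
    (M 5 117 = 1 / 2 * (∑ i, ∑ j with G.Adj i j, ((g ^ 3) i i : ℚ) * (k j - 1))
        - 6 * M 3 7 - 2 * M 4 15 - 4 * M 4 31) ∧
    -- spinning top
    (M 5 119 = edgeSum G (fun i j =>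
          if 2 < k i ∧ 2 < k j then
            (((g ^ 2) i j : ℚ) - 1) *
              ∑ r ∈ (G.commonNeighbors i j).toFinset with 1 < k r, ((k r : ℚ) - 2)
          else 0)
        - 12 * M 4 63) ∧
    -- kite
    (M 5 127 = ∑ i with 3 < k i, (graphletCount 3 7 (nbhd G i) : ℚ) * ((k i : ℚ) - 3) ∧
      M 5 127 = 1 / 6 * ∑ i with 3 < k i,
          ((((nbhd G i).adjMatrix ℕ) ^ 3).trace : ℚ) * ((k i : ℚ) - 3)) ∧
    -- ufo
    (M 5 222 = 1 / 2 * ∑ i with 2 < k i, ∑ j with i ≠ j ∧ 2 < k j,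
          (((g ^ 2) i j).choose 3 : ℚ) ∧
      M 5 222 = 1 / 12 * ∑ i with 2 < k i, ∑ j with i ≠ j ∧ 2 < k j,
          ((g ^ 2) i j : ℚ) * ((g ^ 2) i j - 1) * ((g ^ 2) i j - 2)) ∧
    -- chevron
    (M 5 223 = 1 / 2 * ∑ i with 3 < k i, ∑ j with i ≠ j ∧ 3 < k j,
          (((g ^ 2) i j * g i j).choose 3 : ℚ) ∧
      M 5 223 = 1 / 6 * edgeSum G (fun i j =>
          if 3 < k i ∧ 3 < k j then
            ((g ^ 2) i j : ℚ) * ((g ^ 2) i j - 1) * ((g ^ 2) i j - 2)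
          else 0)) ∧
    -- hourglass
    (M 5 235 = (∑ i with 2 < k i, Ring.choose (1 / 2 * ((g ^ 3) i i : ℚ)) 2) - 2 * M 4 31 ∧
      M 5 235 = 1 / 8 * (∑ i with 2 < k i, ((g ^ 3) i i : ℚ) * ((g ^ 3) i i - 2))
        - 2 * M 4 31) ∧
    -- 5-circle
    (M 5 236 = 1 / 10 * (((g ^ 5).trace : ℚ) - 30 * M 3 7 - 10 * M 4 15)) ∧
    -- house
    (M 5 237 = edgeSum G (fun i j => ((g ^ 3) i j : ℚ) * ((g ^ 2) i j : ℚ))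
        - 9 * M 3 7 - 2 * M 4 15 - 4 * M 4 31) ∧
    -- crown
    (M 5 239 = ∑ i with 3 < k i, (graphletCount 4 13 (nbhd G i) : ℚ) ∧
      M 5 239 = ∑ i with 3 < k i,
          (edgeSum (nbhd G i) (fun j r =>
              (((nbhd G i).degree j : ℚ) - 1) * (((nbhd G i).degree r : ℚ) - 1))
            - 3 * (graphletCount 3 7 (nbhd G i) : ℚ))) ∧
    -- envelope (the inner sum is over unordered pairs `{r, q}`)
    (M 5 254 = edgeSum G (fun i j =>
          if 2 < k i ∧ 2 < k j then
            1 / 2 * ∑ r ∈ (G.commonNeighbors i j).toFinset with 2 < k r,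
              ∑ q ∈ (G.commonNeighbors i j).toFinset with r ≠ q ∧ 2 < k q,
                (((g ^ 2) r q : ℚ) - 2)
          else 0)) ∧
    -- lamp
    (M 5 255 = 1 / 2 * ∑ i with 3 < k i, (graphletCount 4 15 (nbhd G i) : ℚ) ∧
      M 5 255 = 1 / 4 * ∑ i with 3 < k i, ∑ r with 2 < (nbhd G i).degree r,
          ((((nbhd G i).adjMatrix ℕ) ^ 3) r r : ℚ) * (((nbhd G i).degree r : ℚ) - 2)) ∧
    -- arrowhead
    (M 5 507 = ∑ i with 3 < k i, (graphletCount 4 30 (nbhd G i) : ℚ) ∧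
      M 5 507 = 1 / 8 * ∑ i with 3 < k i,
          (((((nbhd G i).adjMatrix ℕ) ^ 4).trace : ℚ)
            - 2 * ((nbhd G i).edgeFinset.card : ℚ)
            - 4 * (graphletCount 3 3 (nbhd G i) : ℚ))) ∧
    -- cat's cradle
    (M 5 511 = 1 / 3 * ∑ i with 3 < k i, (graphletCount 4 31 (nbhd G i) : ℚ) ∧
      M 5 511 = 1 / 6 * ∑ i with 3 < k i,
          ∑ r with 2 < (nbhd G i).degree r, ∑ s with r ≠ s ∧ 2 < (nbhd G i).degree s,
            (((((nbhd G i).adjMatrix ℕ) ^ 2) r s * (nbhd G i).adjMatrix ℕ r s).choose 2 : ℚ)) ∧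
    -- 5-complete
    (M 5 1023 = 1 / 5 * ∑ i with 3 < k i, (graphletCount 4 63 (nbhd G i) : ℚ) ∧
      M 5 1023 = 1 / 120 * ∑ i with 3 < k i, ∑ j with 2 < (nbhd G i).degree j,
          ((((nbhd (nbhd G i) j).adjMatrix ℕ) ^ 3).trace : ℚ)) := by
  intro g k M
  refine ⟨⟨starFive_formula_choose G, starFive_formula G⟩,
    ⟨arrow_formula_choose G, arrow_formula G⟩,
    ⟨cricket_formula_choose G, cricket_formula G⟩,
    pathFive_formula G, bull_formula G,
    ⟨banner_formula_choose G, banner_formula G⟩,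
    ⟨stingray_formula_choose G, stingray_formula G⟩,
    lollipop_formula G, spinningTop_formula G,
    ⟨kite_formula G, kite_formula_trace G⟩,
    ⟨ufo_formula_choose G, ufo_formula G⟩,
    ⟨chevron_formula_choose G, chevron_formula G⟩,
    ⟨hourglass_formula_choose G, hourglass_formula G⟩,
    cycleFive_formula G, house_formula G,
    ⟨crown_formula G, ?_⟩, envelope_formula G, ⟨lamp_formula G, ?_⟩,
    ⟨arrowhead_formula G, ?_⟩, ⟨catsCradle_formula G, ?_⟩, ⟨completeFive_formula G, ?_⟩⟩
  -- The remaining second forms apply the four-node formulae inside each neighbourhood and multiply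
  -- the constants.
  · exact (crown_formula G).trans (Finset.sum_congr rfl fun i _ => pathFour_formula (nbhd G i))
  · refine (lamp_formula G).trans ?_
    rw [Finset.sum_congr rfl fun i _ => paw_formula (nbhd G i), ← Finset.mul_sum, ← mul_assoc]
    exact congrArg₂ (· * ·) (by norm_num) rfl
  · refine (arrowhead_formula G).trans ?_
    rw [Finset.mul_sum]
    exact Finset.sum_congr rfl fun i _ => cycleFour_formula (nbhd G i)
  · refine (catsCradle_formula G).trans ?_
    rw [Finset.sum_congr rfl fun i _ => diamond_formula (nbhd G i), ← Finset.mul_sum, ← mul_assoc]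
    exact congrArg₂ (· * ·) (by norm_num) rfl
  · refine (completeFive_formula G).trans ?_
    rw [Finset.sum_congr rfl fun i _ => completeFour_formula (nbhd G i), ← Finset.mul_sum,
      ← mul_assoc]
    exact congrArg₂ (· * ·) (by norm_num) rfl
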